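/- Let $\mathbb{H}^n=\mathbb{C}^n\times\mathbb{R}$ be the Heisenberg group with group law $(z,t)(w,s)=(z+w,\,t+s+\tfrac12\operatorname{Im}(z\cdot\overline{w}))$ and Haar measure $dz\,dt$; points are also written $(x,y,t)$ with $z=x+iy$, $x,y\in\mathbb{R}^n$. For $a\in\mathbb{H}^n$ let $L_af(h)=f(a^{-1}h)$. For $\lambda\in\mathbb{R}\setminus\{0\}$ let $\pi_\lambda(z,t)\psi(\xi)=e^{2\pi i\lambda t}e^{2\pi i\lambda(x\cdot\xi+\frac12x\cdot y)}\psi(\xi+y)$ for $\psi\in L^2(\mathbb{R}^n)$, and let $\widehat f(\lambda)=\int_{\mathbb{H}^n}f(z,t)\,\pi_\lambda(z,t)\,dz\,dt$ be the group Fourier transform, extended by continuity from $L^1\cap L^2(\mathbb{H}^n)$ to $L^2(\mathbb{H}^n)\to L^2(\mathbb{R}\setminus\{0\},\mathcal{B}_2;|\lambda|^n d\lambda)$, where $\mathcal{B}_2$ is the space of Hilbert–Schmidt operators on $L^2(\mathbb{R}^n)$. For $f\in L^2(\mathbb{H}^n)$ let $f^\lambda(z)=\int_{\mathbb{R}}f(z,t)e^{2\pi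 i\lambda t}\,dt$, and for $g\in L^2(\mathbb{C}^n)$ let $K^\lambda_g(\xi,\eta)=\int_{\mathbb{R}^n}g(x,\eta-\xi)e^{i\pi\lambda x\cdot(\xi+\eta)}\,dx$, both integrals being understood as limits in $L^2$ of the integrals over balls of radius $N\to\infty$. For $\varphi,\psi\in L^2(\mathbb{H}^n)$, $k,l\in\mathbb{Z}^n$ and $\lambda\in(0,1]$ put $$G^\varphi_{k,l}(\lambda)=\sum_{r\in\mathbb{Z}}\sum_{s\in\mathbb{Z}^n}\int_{[0,1)^n}\int_{\mathbb{R}^n}K^{\lambda+r}_{\varphi^{\lambda+r}}(\xi+s,\eta)\,\overline{K^{\lambda+r}_{\varphi^{\lambda+r}}(\xi+s+l,\eta)}\,e^{-2\pi i(\lambda+r)k\cdot(l+2\xi)}e^{-4\pi i\lambda k\cdot s}\,d\eta\,d\xi\,|\lambda+r|^n,$$ $$[\varphi,\psi](\lambda)=\sum_{r\in\mathbb{Z}}\langle\widehat\varphi(\lambda+r),\widehat\psi(\lambda+r)\rangle_{\mathcal{B}_2}|\lambda+r|^n,\qquad \langle A,B\rangle_{\mathcal{B}_2}=\operatorname{tr}(B^*A).$$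 The function $\varphi$ satisfies condition C if, for every $(k,l)\in\mathbb{Z}^{2n}\setminus\{(0,0)\}$, $G^\varphi_{k,l}(\lambda)=0$ for a.e. $\lambda\in(0,1]$. Theorem. For every $\varphi\in L^2(\mathbb{H}^n)$ the following are equivalent: (a) $\{L_{(2k,l,m)}\varphi:(k,l,m)\in\mathbb{Z}^{2n+1}\}$ is an orthonormal system in $L^2(\mathbb{H}^n)$; (b) $G^\varphi_{0,0}(\lambda)=1$ for a.e. $\lambda\in(0,1]$, and $\varphi$ satisfies condition C; (c) for every $(k,l)\in\mathbb{Z}^{2n}$, $[\varphi,L_{(2k,l,0)}\varphi](\lambda)=\delta_{(k,l),(0,0)}$ for a.e. $\lambda\in(0,1]$. -/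

import Mathlib

open MeasureTheory Filter Topology

noncomputable section

/-- Euclidean space `ℝⁿ`; the dot product is `inner ℝ x y`, the measure is Lebesgue measure. -/
abbrev EucSp (n : ℕ) : Type := EuclideanSpace ℝ (Fin n)

/-- The Heisenberg group `ℍⁿ = ℂⁿ × ℝ`, the point `(x + iy, t)` being written `((x, y), t)`.
Its Haar measure is Lebesgue measure `dx dy dt`, i.e. `volume`. -/
abbrev Heis (n : ℕ) : Type := (EucSp n × EucSp n) × ℝ

/-- The group law `(z,t)·(w,s) = (z + w, t + s + ½ Im (z · w̄))`; for `z = x + iy`, `w = u + iv`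
one has `Im (z · w̄) = y·u - x·v`. -/
def heisMul {n : ℕ} (p q : Heis n) : Heis n :=
  (p.1 + q.1, p.2 + q.2 + (1 / 2) * (inner ℝ p.1.2 q.1.1 - inner ℝ p.1.1 q.1.2))

/-- The group inverse `(z,t)⁻¹ = (-z,-t)`. -/
def heisInv {n : ℕ} (p : Heis n) : Heis n := (-p.1, -p.2)

/-- The Hilbert space `L²(ℍⁿ)`. -/
abbrev L2Heis (n : ℕ) : Type := Lp ℂ 2 (volume : Measure (Heis n))

/-- The Hilbert space `L²(ℝⁿ)`. -/
abbrev L2Euc (n : ℕ) : Type := Lp ℂ 2 (volume : Measure (EucSp n))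

/-- Lebesgue measure is invariant under left translations of `ℍⁿ`. -/
theorem measurePreserving_heisMul {n : ℕ} (a : Heis n) :
    MeasurePreserving (heisMul a) (volume : Measure (Heis n)) volume := by
  have : (volume : Measure (EucSp n × EucSp n)).IsAddLeftInvariant :=
    inferInstanceAs (((volume : Measure (EucSp n)).prod volume).IsAddLeftInvariant)
  have h1 : MeasurePreserving (fun z : EucSp n × EucSp n => a.1 + z) volume volume :=
    measurePreserving_add_left volume a.1
  refine MeasurePreserving.skew_product (f := fun z : EucSp n × EucSp n => a.1 + z)
    (g := fun z s => a.2 + s + (1 / 2) * (inner ℝ a.1.2 z.1 - inner ℝ a.1.1 z.2)) h1 ?_ ?_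
  · exact Continuous.measurable (by fun_prop)
  · refine Filter.Eventually.of_forall fun z => ?_
    have h2 := (measurePreserving_add_right (volume : Measure ℝ)
      (a.2 + (1 / 2) * (inner ℝ a.1.2 z.1 - inner ℝ a.1.1 z.2))).map_eq
    have h3 : (fun s : ℝ => a.2 + s + (1 / 2) * (inner ℝ a.1.2 z.1 - inner ℝ a.1.1 z.2)) =
        fun s => s + (a.2 + (1 / 2) * (inner ℝ a.1.2 z.1 - inner ℝ a.1.1 z.2)) := by
      funext s
      ring
    rw [h3]
    exact h2

/-- Left translation on `L²(ℍⁿ)`: `(L_a f)(h) = f (a⁻¹ h)`. -/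
def leftTrans {n : ℕ} (a : Heis n) (f : L2Heis n) : L2Heis n :=
  Lp.compMeasurePreserving (heisMul (heisInv a)) (measurePreserving_heisMul (heisInv a)) f

/-- An integer vector as an element of `ℝⁿ`. -/
def intVec {n : ℕ} (k : Fin n → ℤ) : EucSp n := WithLp.toLp 2 (fun i => (k i : ℝ))

/-- The lattice point `(2k, l, m)` of `ℍⁿ`. -/
def latPt {n : ℕ} (k l : Fin n → ℤ) (m : ℤ) : Heis n :=
  (((2 : ℝ) • intVec k, intVec l), (m : ℝ))

/-! ### The group Fourier transform -/

/-- The function `ξ ↦ e^{2πiλt} e^{2πiλ(x·ξ + ½ x·y)} ψ(ξ + y)` on `ℝⁿ`. -/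
def schrodingerFun {n : ℕ} (lam : ℝ) (p : Heis n) (ψ : EucSp n → ℂ) (ξ : EucSp n) : ℂ :=
  Complex.exp (2 * Real.pi * lam * p.2 * Complex.I) *
    Complex.exp (2 * Real.pi * lam *
      ((inner ℝ p.1.1 ξ + (1 / 2) * inner ℝ p.1.1 p.1.2 : ℝ) : ℂ) * Complex.I) *
    ψ (ξ + p.1.2)

theorem memLp_schrodingerFun {n : ℕ} (lam : ℝ) (p : Heis n) (ψ : L2Euc n) :
    MemLp (schrodingerFun lam p ψ) 2 volume := by
  have h1 : MemLp (fun ξ : EucSp n => ψ (ξ + p.1.2)) 2 volume :=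
    (Lp.memLp ψ).comp_measurePreserving (measurePreserving_add_right volume p.1.2)
  refine h1.of_le ?_ (Filter.Eventually.of_forall fun ξ => ?_)
  · refine AEStronglyMeasurable.mul (Continuous.aestronglyMeasurable ?_) h1.1
    fun_prop
  · have e1 : ‖Complex.exp (2 * Real.pi * lam * p.2 * Complex.I)‖ = 1 := by
      exact_mod_cast Complex.norm_exp_ofReal_mul_I (2 * Real.pi * lam * p.2)
    have e2 : ‖Complex.exp (2 * Real.pi * lam *
      ((inner ℝ p.1.1 ξ + (1 / 2) * inner ℝ p.1.1 p.1.2 : ℝ) : ℂ) * Complex.I)‖ = 1 := by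
      exact_mod_cast Complex.norm_exp_ofReal_mul_I
        (2 * Real.pi * lam * (inner ℝ p.1.1 ξ + (1 / 2) * inner ℝ p.1.1 p.1.2))
    rw [schrodingerFun, norm_mul, norm_mul, e1, e2, one_mul, one_mul]

/-- The Schrödinger representation `π_λ(z,t)` acting on `L²(ℝⁿ)`. -/
def schrodinger {n : ℕ} (lam : ℝ) (p : Heis n) (ψ : L2Euc n) : L2Euc n :=
  (memLp_schrodingerFun lam p ψ).toLp

/-- The group Fourier transform of an integrable function `f` on `ℍⁿ`: the operator
`ψ ↦ ∫ f(z,t) π_λ(z,t) ψ dz dt` on `L²(ℝⁿ)` (the integral is taken in the strong sense). -/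
def groupFourierL1 {n : ℕ} (f : Heis n → ℂ) (lam : ℝ) (ψ : L2Euc n) : L2Euc n :=
  ∫ p, f p • schrodinger lam p ψ

/-- The index set of a fixed orthonormal basis of `L²(ℝⁿ)`. -/
def onbIndex (n : ℕ) : Set (L2Euc n) := (exists_hilbertBasis ℂ (L2Euc n)).choose

/-- A fixed orthonormal basis of `L²(ℝⁿ)`. -/
def onb (n : ℕ) : HilbertBasis (onbIndex n) ℂ (L2Euc n) :=
  (exists_hilbertBasis ℂ (L2Euc n)).choose_spec.choose

/-- The squared Hilbert–Schmidt norm `∑ᵢ ‖A eᵢ‖²`, with value `∞` if `A` is not Hilbert–Schmidt. -/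
def hsNormSq {n : ℕ} (A : L2Euc n → L2Euc n) : ENNReal :=
  ∑' i, ‖A (onb n i)‖ₑ ^ 2

/-- The Hilbert–Schmidt inner product `⟨A, B⟩ = tr (B* A) = ∑ᵢ ⟨A eᵢ, B eᵢ⟩`, linear in `A`
(Mathlib's inner product on `L²(ℝⁿ)` is linear in its second argument). -/
def hsInner {n : ℕ} (A B : L2Euc n →L[ℂ] L2Euc n) : ℂ :=
  ∑' i, inner ℂ (B (onb n i)) (A (onb n i))

/-- `Φ` is a version of the group Fourier transform of `f ∈ L²(ℍⁿ)`: it is a (weakly measurable)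
element of `L²(ℝ*, 𝓑₂; |λ|ⁿ dλ)`, and it is the limit in that space of the group Fourier transforms
of the functions `f · 1_{B_N} ∈ L¹ ∩ L²`, where `B_N` is the closed ball of radius `N`. -/
structure IsGroupFourier {n : ℕ} (f : L2Heis n) (Φ : ℝ → L2Euc n →L[ℂ] L2Euc n) : Prop where
  measurable : ∀ ψ χ : L2Euc n, Measurable fun lam => inner ℂ χ (Φ lam ψ)
  finite : ∫⁻ lam : ℝ, hsNormSq (Φ lam) * ENNReal.ofReal (|lam| ^ n) < ⊤
  tendsto : Tendsto (fun N : ℕ => ∫⁻ lam : ℝ,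
      hsNormSq (fun ψ => Φ lam ψ -
        groupFourierL1 (Set.indicator (Metric.closedBall 0 (N : ℝ)) f) lam ψ) *
        ENNReal.ofReal (|lam| ^ n)) atTop (𝓝 0)

open Classical in
/-- The group Fourier transform `λ ↦ f̂(λ)` on `L²(ℍⁿ)` (well defined for almost every `λ`). -/
def groupFourier {n : ℕ} (f : L2Heis n) : ℝ → L2Euc n →L[ℂ] L2Euc n :=
  if h : ∃ Φ, IsGroupFourier f Φ then h.choose else 0

/-- The bracket map `[φ,ψ](λ) = ∑_{r ∈ ℤ} ⟨φ̂(λ+r), ψ̂(λ+r)⟩_{𝓑₂} |λ+r|ⁿ`. -/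
def bracket {n : ℕ} (φ ψ : L2Heis n) (lam : ℝ) : ℂ :=
  ∑' r : ℤ, hsInner (groupFourier φ (lam + r)) (groupFourier ψ (lam + r)) *
    ((|lam + r| ^ n : ℝ) : ℂ)

/-! ### The functions `f^λ`, the kernel of the Weyl transform, and `G_{k,l}` -/

/-- `F(z, λ)` is a version of `f^λ(z) = ∫ f(z,t) e^{2πiλt} dt`, the inverse Fourier transform of
`f ∈ L²(ℍⁿ)` in the variable `t`: the limit in `L²` of the integrals over `[-N, N]`. -/
structure IsFourierT {n : ℕ} (f : L2Heis n) (F : (EucSp n × EucSp n) × ℝ → ℂ) : Prop where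
  memLp : MemLp F 2 volume
  tendsto : Tendsto (fun N : ℕ => eLpNorm (fun q : (EucSp n × EucSp n) × ℝ =>
      F q - ∫ t in Set.Icc (-(N : ℝ)) N,
        f (q.1, t) * Complex.exp (2 * Real.pi * q.2 * t * Complex.I)) 2 volume) atTop (𝓝 0)

open Classical in
/-- The function `f^λ` on `ℂⁿ`, for `f ∈ L²(ℍⁿ)` (well defined a.e. on `ℂⁿ` for a.e. `λ`). -/
def fourierT {n : ℕ} (f : L2Heis n) (lam : ℝ) (z : EucSp n × EucSp n) : ℂ :=
  if h : ∃ F, IsFourierT f F then h.choose (z, lam) else 0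

/-- `K(ξ, η)` is a version of the kernel `K_g^λ(ξ,η) = ∫ g(x, η-ξ) e^{iπλ x·(ξ+η)} dx` of the Weyl
transform `W_λ(g)`, for `g ∈ L²(ℂⁿ)`: the limit in `L²` of the integrals over `|x| ≤ N`. -/
structure IsWeylKernel {n : ℕ} (lam : ℝ) (g : EucSp n × EucSp n → ℂ)
    (K : EucSp n × EucSp n → ℂ) : Prop where
  memLp : MemLp K 2 volume
  tendsto : Tendsto (fun N : ℕ => eLpNorm (fun q : EucSp n × EucSp n =>
      K q - ∫ x in Metric.closedBall (0 : EucSp n) (N : ℝ),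
        g (x, q.2 - q.1) *
          Complex.exp (Real.pi * lam * ((inner ℝ x (q.1 + q.2) : ℝ) : ℂ) * Complex.I))
      2 volume) atTop (𝓝 0)

open Classical in
/-- The kernel `K_g^λ` of the Weyl transform `W_λ(g)`, for `g ∈ L²(ℂⁿ)` and `λ ≠ 0`
(well defined a.e. on `ℝⁿ × ℝⁿ`). -/
def weylKernel {n : ℕ} (lam : ℝ) (g : EucSp n × EucSp n → ℂ) (ξ η : EucSp n) : ℂ :=
  if h : ∃ K, IsWeylKernel lam g K then h.choose (ξ, η) else 0

/-- The torus `𝕋ⁿ`, realised as the cube `[0,1)ⁿ`. -/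
def unitCube (n : ℕ) : Set (EucSp n) := {ξ | ∀ i, ξ i ∈ Set.Ico (0 : ℝ) 1}

/-- The function `G_{k,l}^φ`. -/
def G {n : ℕ} (φ : L2Heis n) (k l : Fin n → ℤ) (lam : ℝ) : ℂ :=
  ∑' r : ℤ, ∑' s : Fin n → ℤ,
    (∫ ξ in unitCube n, ∫ η : EucSp n,
      weylKernel (lam + r) (fourierT φ (lam + r)) (ξ + intVec s) η *
      (starRingEnd ℂ)
        (weylKernel (lam + r) (fourierT φ (lam + r)) (ξ + intVec s + intVec l) η) *
      Complex.exp (-(2 * Real.pi * (lam + r) *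
        ((inner ℝ (intVec k) (intVec l + (2 : ℝ) • ξ) : ℝ) : ℂ) * Complex.I)) *
      Complex.exp (-(4 * Real.pi * lam *
        ((inner ℝ (intVec k) (intVec s) : ℝ) : ℂ) * Complex.I))) *
    ((|lam + r| ^ n : ℝ) : ℂ)

/-- Condition C: `G_{k,l}^φ = 0` a.e. on `(0,1]` for all `(k,l) ≠ (0,0)`. -/
def ConditionC {n : ℕ} (φ : L2Heis n) : Prop :=
  ∀ k l : Fin n → ℤ, (k, l) ≠ (0, 0) →
    ∀ᵐ lam ∂(volume.restrict (Set.Ioc (0 : ℝ) 1)), G φ k l lam = 0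

/-- The translates `L_{(2k,l,m)} φ`, `(k,l,m) ∈ ℤ^{2n+1}`, form an orthonormal system. -/
def TranslatesOrthonormal {n : ℕ} (φ : L2Heis n) : Prop :=
  Orthonormal ℂ fun p : ((Fin n → ℤ) × (Fin n → ℤ)) × ℤ =>
    leftTrans (latPt p.1.1 p.1.2 p.2) φ

end

/-!
The bracket `[φ, L_{(2k,l,0)} φ]` is at the centre: it equals `G_{k,l}` almost everywhere, and its
Fourier coefficients on `(0,1]` are the inner products of `φ` with its lattice translates.

Everything is done fibrewise in `λ`. The Fourier transform in the central variable
(`centralFourier`) is an isometry of `L²(ℍⁿ)`, so that `φ ∈ L²(ℍⁿ)` has slices `φ^λ ∈ L²(ℂⁿ)`. For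
each `λ ≠ 0` the map from `φ^λ` to the kernel of its Weyl transform (`weylFourier`) is `|λ|^{-n/2}`
times an isometry of `L²(ℂⁿ)`. Both are given by integrals only on functions of bounded support in
the integration variable and are extended by continuity (`exists_L2_extension`), starting from
Plancherel's theorem on `L¹ ∩ L²`. The group Fourier transform `φ̂(λ)` is the integral operator with
this kernel (`groupFourier_ae_eq`): on truncations of `φ` this is Fubini's theorem
(`groupFourierL1_eq_kernelOp`), and the Hilbert–Schmidt norm of an integral operator is the
`L²` norm of its kernel. Hence `⟨φ̂(λ), ψ̂(λ)⟩ |λ|ⁿ = ⟨φ^λ, ψ^λ⟩` (`hsInner_groupFourier_mul`).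

Left translation by `(2k, l, 0)` multiplies the kernel by a phase and translates it by `l` in the
first variable (`slice_leftTrans`, `weylFourier_twist`). Cutting the resulting integral over `ℝⁿ`
into unit cubes gives `G_{k,l} = [φ, L_{(2k,l,0)} φ]` (`G_ae_eq_bracket`). Translation by the
central element `m` multiplies `φ^λ` by `e^{2πiλm}`, so folding the integral over `λ ∈ ℝ` onto `(0,1]`
yields `⟨φ, L_{(2k,l,m)} φ⟩` as the `m`-th Fourier coefficient of the bracket (`integral_bracket`).
Orthonormality of the translates is a statement about these inner products, because the points
`(2k, l, m)` form a subgroup, and it translates into a statement about the bracket because an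
integrable function on `(0,1]` is determined by its Fourier coefficients
(`ae_eq_zero_of_fourier_coeff_eq_zero`).
-/

open MeasureTheory Filter Topology

noncomputable section

variable {n : ℕ}

/-! ### Plancherel's theorem for integrable functions -/

open FourierTransform SchwartzMap in
/-- On `L¹ ∩ L²` the `L²` inverse Fourier transform is given by the Fourier integral. -/
theorem fourierInv_toLp_ae_eq {V : Type*} [NormedAddCommGroup V] [InnerProductSpace ℝ V]
    [FiniteDimensional ℝ V] [MeasurableSpace V] [BorelSpace V] {f : V → ℂ}
    (h1 : Integrable f) (h2 : MemLp f 2) :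
    ((𝓕⁻ (h2.toLp f) : Lp ℂ 2 (volume : Measure V)) : V → ℂ) =ᵐ[volume] 𝓕⁻ f := by
  have hL : Continuous fun p : V × V => (-innerₗ V) p.1 p.2 := by
    have := (continuous_inner (𝕜 := ℝ) (E := V)).neg
    exact this
  have hcont : Continuous (𝓕⁻ f) :=
    VectorFourier.fourierIntegral_continuous Real.continuous_fourierChar hL h1
  refine ae_eq_of_integral_contDiff_smul_eq ?_ hcont.locallyIntegrable fun g hg hgs => ?_
  · exact (Lp.memLp _).locallyIntegrable (by norm_num)
  have hgs' : HasCompactSupport (fun x => (g x : ℂ)) :=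
    hgs.comp_left (g := fun r : ℝ => (r : ℂ)) (by simp)
  let G : 𝓢(V, ℂ) := hgs'.toSchwartzMap (Complex.ofRealCLM.contDiff.comp hg)
  have hG : ∀ x, G x = (g x : ℂ) := fun x => rfl
  have key := DFunLike.congr_fun (Lp.fourierInv_toTemperedDistribution_eq (h2.toLp f)) G
  rw [TemperedDistribution.fourierInv_apply, Lp.toTemperedDistribution_apply,
    Lp.toTemperedDistribution_apply] at key
  simp_rw [hG] at key
  calc ∫ x, g x • (𝓕⁻ (h2.toLp f) : Lp ℂ 2 (volume : Measure V)) x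
      = ∫ x, (g x : ℂ) • (𝓕⁻ (h2.toLp f) : Lp ℂ 2 (volume : Measure V)) x := by
        simp only [Complex.real_smul, smul_eq_mul]
    _ = ∫ x, (𝓕⁻ G) x • (h2.toLp f) x := key.symm
    _ = ∫ x, (𝓕⁻ (G : V → ℂ)) x • f x := by
        refine integral_congr_ae ?_
        filter_upwards [h2.coeFn_toLp] with x hx
        rw [hx, SchwartzMap.fourierInv_coe]
    _ = ∫ x, G x • (𝓕⁻ f : V → ℂ) x := by
        have := VectorFourier.integral_fourierIntegral_smul_eq_flip (μ := (volume : Measure V))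
          (ν := (volume : Measure V)) (L := -innerₗ V) Real.continuous_fourierChar hL
          G.integrable h1
        have hflip : (-innerₗ V).flip = -innerₗ V := by
          ext x y
          simp [real_inner_comm]
        rw [hflip] at this
        exact this
    _ = ∫ x, g x • (𝓕⁻ f : V → ℂ) x := by simp [hG]

/-- Plancherel's theorem on `L¹ ∩ L²`. -/
theorem lintegral_fourierInt_sq {V : Type*} [NormedAddCommGroup V] [InnerProductSpace ℝ V]
    [FiniteDimensional ℝ V] [MeasurableSpace V] [BorelSpace V] {f : V → ℂ}
    (h1 : Integrable f) (h2 : MemLp f 2) :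
    ∫⁻ w, ‖∫ x, f x * Complex.exp (2 * Real.pi * ((inner ℝ x w : ℝ) : ℂ) * Complex.I)‖ₑ ^ 2 =
      ∫⁻ x, ‖f x‖ₑ ^ 2 := by
  have e : ∀ w, ∫ x, f x * Complex.exp (2 * Real.pi * ((inner ℝ x w : ℝ) : ℂ) * Complex.I) =
      FourierTransformInv.fourierInv f w := fun w => by
    rw [Real.fourierInv_eq']
    refine integral_congr_ae (Eventually.of_forall fun x => ?_)
    simp [mul_comm]
  simp_rw [e]
  have a1 := fourierInv_toLp_ae_eq h1 h2
  have a2 : ‖FourierTransformInv.fourierInv (h2.toLp f)‖ = ‖h2.toLp f‖ :=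
    (Lp.fourierTransformₗᵢ V ℂ).symm.norm_map _
  have a3 : eLpNorm (FourierTransformInv.fourierInv f) 2 volume = eLpNorm f 2 volume := by
    rw [← eLpNorm_congr_ae a1, ← eLpNorm_congr_ae h2.coeFn_toLp]
    rw [Lp.norm_def, Lp.norm_def] at a2
    exact (ENNReal.toReal_eq_toReal_iff' (Lp.eLpNorm_ne_top _) (Lp.eLpNorm_ne_top _)).1 a2
  have := congrArg (· ^ (2 : ℝ)) a3
  simp only [eLpNorm_eq_lintegral_rpow_enorm_toReal two_ne_zero ENNReal.ofNat_ne_top,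
    ENNReal.toReal_ofNat, ← ENNReal.rpow_mul] at this
  norm_num at this
  exact this

theorem eLpNorm_two_sq {X : Type*} [MeasurableSpace X] {μ : Measure X} {E : Type*}
    [NormedAddCommGroup E] (f : X → E) : eLpNorm f 2 μ ^ 2 = ∫⁻ x, ‖f x‖ₑ ^ 2 ∂μ := by
  rw [eLpNorm_eq_lintegral_rpow_enorm_toReal two_ne_zero ENNReal.ofNat_ne_top]
  rw [← ENNReal.rpow_natCast, ← ENNReal.rpow_mul]
  norm_num

theorem memLp_two_iff {X : Type*} [MeasurableSpace X] {μ : Measure X} {E : Type*}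
    [NormedAddCommGroup E] {f : X → E} (hf : AEStronglyMeasurable f μ) :
    MemLp f 2 μ ↔ ∫⁻ x, ‖f x‖ₑ ^ 2 ∂μ < ⊤ := by
  rw [← eLpNorm_two_sq, MemLp, ENNReal.pow_lt_top_iff]
  simp [hf]

theorem enorm_sq_eq_lintegral {X : Type*} [MeasurableSpace X] {μ : Measure X}
    (f : Lp ℂ 2 μ) : ‖f‖ₑ ^ 2 = ∫⁻ x, ‖f x‖ₑ ^ 2 ∂μ := by
  rw [← eLpNorm_two_sq, Lp.enorm_def]

/-- Truncations to an exhausting sequence of sets converge in `L²`. -/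
theorem tendsto_eLpNorm_indicator_sub {X : Type*} [MeasurableSpace X] {μ : Measure X}
    {A : ℕ → Set X} (hA : ∀ N, MeasurableSet (A N)) (hmono : Monotone A)
    (hU : ∀ x, ∃ N, x ∈ A N) {f : X → ℂ} (hf : MemLp f 2 μ) :
    Tendsto (fun N => eLpNorm (fun x => (A N).indicator f x - f x) 2 μ) atTop (𝓝 0) := by
  have h1 : Tendsto (fun N => ∫⁻ x, ‖(A N).indicator f x - f x‖ₑ ^ 2 ∂μ) atTop (𝓝 0) := by
    have h0 : ∫⁻ _x : X, (0 : ENNReal) ∂μ = 0 := lintegral_zero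
    rw [← h0]
    refine tendsto_lintegral_of_dominated_convergence' (fun x => ‖f x‖ₑ ^ 2) (fun N => ?_)
      (fun N => Eventually.of_forall fun x => ?_) ?_ (Eventually.of_forall fun x => ?_)
    · exact ((hf.1.indicator (hA N)).sub hf.1).enorm.pow_const 2
    · by_cases hx : x ∈ A N <;> simp [hx]
    · exact ((memLp_two_iff hf.1).1 hf).ne
    · obtain ⟨N, hN⟩ := hU x
      refine tendsto_const_nhds.congr' ?_
      filter_upwards [eventually_ge_atTop N] with M hM
      simp [hmono hM hN]
  have h2 := ((ENNReal.continuous_rpow_const (y := 1 / 2)).tendsto 0).comp h1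
  simp only [one_div, ENNReal.zero_rpow_of_pos (by norm_num : (0 : ℝ) < 2⁻¹)] at h2
  refine h2.congr fun N => ?_
  simp only [Function.comp]
  rw [← eLpNorm_two_sq, ← ENNReal.rpow_natCast, ← ENNReal.rpow_mul]
  norm_num

/-! ### Extension of isometric integral operators to `L²` -/

/-- An operator given by an explicit formula `T` that is linear and a multiple of an isometry on
the `L²` functions supported in some set of an exhausting sequence `A N` extends to all of `L²`,
and the extension is the `L²` limit of the values of `T` on truncations. -/
theorem exists_L2_extension {X Z : Type*} [MeasurableSpace X] [MeasurableSpace Z]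
    {μ : Measure X} {ν : Measure Z} {A : ℕ → Set X} (hA : ∀ N, MeasurableSet (A N))
    (hmono : Monotone A) (hU : ∀ x, ∃ N, x ∈ A N) {c : ℝ} (hc : 0 ≤ c)
    {T : (X → ℂ) → Z → ℂ}
    (hmeas : ∀ f, AEStronglyMeasurable f μ → AEStronglyMeasurable (T f) ν)
    (hcongr : ∀ f g, AEStronglyMeasurable f μ → AEStronglyMeasurable g μ →
      f =ᵐ[μ] g → T f =ᵐ[ν] T g)
    (hadd : ∀ f g N, MemLp f 2 μ → MemLp g 2 μ → (∀ x, x ∉ A N → f x = 0) →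
      (∀ x, x ∉ A N → g x = 0) → T (f + g) =ᵐ[ν] T f + T g)
    (hsmul : ∀ (a : ℂ) f, T (a • f) = a • T f)
    (hnorm : ∀ f N, MemLp f 2 μ → (∀ x, x ∉ A N → f x = 0) →
      eLpNorm (T f) 2 ν = ENNReal.ofReal c * eLpNorm f 2 μ) :
    ∃ U : Lp ℂ 2 μ →L[ℂ] Lp ℂ 2 ν, (∀ f, ‖U f‖ = c * ‖f‖) ∧
      (∀ f (hf : MemLp f 2 μ) N, (∀ x, x ∉ A N → f x = 0) → U (hf.toLp f) =ᵐ[ν] T f) ∧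
      ∀ f : Lp ℂ 2 μ, Tendsto (fun N => eLpNorm
        (fun z => U f z - T ((A N).indicator f) z) 2 ν) atTop (𝓝 0) := by
  have hind : ∀ N (f : Lp ℂ 2 μ), MemLp ((A N).indicator f) 2 μ := fun N f =>
    (Lp.memLp f).indicator (hA N)
  have hTm : ∀ f N, MemLp f 2 μ → (∀ x, x ∉ A N → f x = 0) → MemLp (T f) 2 ν := by
    intro f N hf hs
    refine ⟨hmeas f hf.1, ?_⟩
    rw [hnorm f N hf hs]
    exact ENNReal.mul_lt_top ENNReal.ofReal_lt_top hf.2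
  have hz : ∀ N (f : X → ℂ) x, x ∉ A N → (A N).indicator f x = 0 := fun N f x hx =>
    Set.indicator_of_notMem hx _
  -- `P N` is truncation to `A N`, and `TN N` is `T` after truncation.
  let P : ℕ → Lp ℂ 2 μ → Lp ℂ 2 μ := fun N f => (hind N f).toLp _
  have hPc : ∀ N f, P N f =ᵐ[μ] (A N).indicator f := fun N f => (hind N f).coeFn_toLp
  have hPt : ∀ f, Tendsto (fun N => P N f) atTop (𝓝 f) := by
    intro f
    rw [tendsto_iff_edist_tendsto_0]
    refine (tendsto_eLpNorm_indicator_sub hA hmono hU (Lp.memLp f)).congr fun N => ?_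
    rw [Lp.edist_def]
    refine eLpNorm_congr_ae ?_
    filter_upwards [hPc N f] with x hx
    simp [hx]
  let TN : ℕ → Lp ℂ 2 μ →ₗ[ℂ] Lp ℂ 2 ν := fun N =>
    { toFun := fun f => (hTm _ N (hind N f) (hz N f)).toLp _
      map_add' := fun f g => by
        rw [← MemLp.toLp_add, MemLp.toLp_eq_toLp_iff]
        refine (hcongr _ _ (hind N _).1 ((hind N f).add (hind N g)).1 ?_).trans
          (hadd _ _ N (hind N f) (hind N g) (hz N f) (hz N g))
        filter_upwards [Lp.coeFn_add f g] with x hx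
        by_cases h : x ∈ A N
        · rw [Set.indicator_of_mem h, hx]
          simp [h]
        · simp [h]
      map_smul' := fun a f => by
        rw [RingHom.id_apply, ← MemLp.toLp_const_smul, MemLp.toLp_eq_toLp_iff, ← hsmul]
        refine hcongr _ _ (hind N _).1 ((hind N f).const_smul a).1 ?_
        filter_upwards [Lp.coeFn_smul a f] with x hx
        by_cases h : x ∈ A N
        · rw [Set.indicator_of_mem h, hx]
          simp [h]
        · simp [h] }
  have hTNc : ∀ N f, TN N f =ᵐ[ν] T ((A N).indicator f) := fun N f =>
    (hTm _ N (hind N f) (hz N f)).coeFn_toLp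
  have hTNn : ∀ N f, ‖TN N f‖ = c * ‖P N f‖ := by
    intro N f
    rw [Lp.norm_def, Lp.norm_def, eLpNorm_congr_ae (hTNc N f), hnorm _ N (hind N f) (hz N f),
      eLpNorm_congr_ae (hPc N f), ENNReal.toReal_mul, ENNReal.toReal_ofReal hc]
  have hPle : ∀ N f, ‖P N f‖ ≤ ‖f‖ := by
    intro N f
    refine Lp.norm_le_norm_of_ae_le ?_
    filter_upwards [hPc N f] with x hx
    rw [hx]
    by_cases h : x ∈ A N <;> simp [h]
  have hTNP : ∀ N M f, N ≤ M → TN M (P N f) = TN N f := by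
    intro N M f hNM
    refine (MemLp.toLp_eq_toLp_iff (hTm _ M (hind M _) (hz M _)) (hTm _ N (hind N f) (hz N f))).2
      (hcongr _ _ (hind M _).1 (hind N f).1 ?_)
    filter_upwards [hPc N f] with x hx
    by_cases h : x ∈ A N
    · simp [h, hmono hNM h, hx]
    · by_cases h' : x ∈ A M <;> simp [h, h', hx]
  have hdist : ∀ N M f, N ≤ M → dist (TN M f) (TN N f) ≤ c * ‖f - P N f‖ := by
    intro N M f hNM
    rw [dist_eq_norm, ← hTNP N M f hNM, ← map_sub, hTNn]
    exact mul_le_mul_of_nonneg_left (hPle _ _) hc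
  have hb : ∀ f, Tendsto (fun N => 2 * (c * ‖f - P N f‖)) atTop (𝓝 0) := by
    intro f
    have := ((((hPt f).const_sub f).norm).const_mul c).const_mul 2
    simpa using this
  have hcau : ∀ f, CauchySeq fun N => TN N f := fun f =>
    cauchySeq_of_le_tendsto_0 _ (fun n m N hn hm => by
      refine (dist_triangle_right _ _ (TN N f)).trans ?_
      have := hdist N n f hn
      have := hdist N m f hm
      linarith) (hb f)
  choose u hu using fun f => cauchySeq_tendsto_of_complete (hcau f)
  have hun : ∀ f, ‖u f‖ = c * ‖f‖ := fun f =>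
    tendsto_nhds_unique (hu f).norm (by
      simp_rw [hTNn]
      exact (hPt f).norm.const_mul c)
  let U0 : Lp ℂ 2 μ →ₗ[ℂ] Lp ℂ 2 ν := linearMapOfTendsto u TN (tendsto_pi_nhds.2 hu)
  refine ⟨U0.mkContinuous c fun f => (hun f).le, hun, fun f hf N hs => ?_, fun f => ?_⟩
  · have : u (hf.toLp f) = (hTm f N hf hs).toLp _ := by
      refine tendsto_nhds_unique (hu _) (tendsto_const_nhds.congr' ?_)
      filter_upwards [eventually_ge_atTop N] with M hM
      refine (MemLp.toLp_eq_toLp_iff (hTm f N hf hs) (hTm _ M (hind M _) (hz M _))).2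
        (hcongr _ _ hf.1 (hind M _).1 ?_)
      filter_upwards [hf.coeFn_toLp] with x hx
      by_cases h : x ∈ A M
      · simp [h, hx]
      · simp [h, hs x (fun h' => h (hmono hM h'))]
    change (u (hf.toLp f) : Z → ℂ) =ᵐ[ν] T f
    rw [this]
    exact (hTm f N hf hs).coeFn_toLp
  · have := tendsto_iff_edist_tendsto_0.1 (hu f)
    refine this.congr fun N => ?_
    rw [edist_comm, Lp.edist_def]
    refine eLpNorm_congr_ae ?_
    filter_upwards [hTNc N f] with z h1
    change u f z - TN N f z = u f z - _
    rw [h1]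

theorem eLpNorm_eq_mul_of_lintegral_sq {X Z : Type*} [MeasurableSpace X] [MeasurableSpace Z]
    {μ : Measure X} {ν : Measure Z} {f : X → ℂ} {g : Z → ℂ} {c : ℝ} (hc : 0 ≤ c)
    (h : ∫⁻ z, ‖g z‖ₑ ^ 2 ∂ν = ENNReal.ofReal (c ^ 2) * ∫⁻ x, ‖f x‖ₑ ^ 2 ∂μ) :
    eLpNorm g 2 ν = ENNReal.ofReal c * eLpNorm f 2 μ := by
  rw [← eLpNorm_two_sq, ← eLpNorm_two_sq, ENNReal.ofReal_pow hc, ← mul_pow] at h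
  exact (ENNReal.pow_right_strictMono two_ne_zero).injective h

/-- Almost every fibre of a square integrable function with bounded support in the second variable
is integrable and square integrable. -/
theorem ae_integrable_memLp_fibre {Y V : Type*} [MeasurableSpace Y] [MeasurableSpace V]
    [NormedAddCommGroup V] [ProperSpace V]
    {μ : Measure Y} [SFinite μ] {ν : Measure V} [SFinite ν] [IsFiniteMeasureOnCompacts ν]
    [OpensMeasurableSpace V]
    {f : Y × V → ℂ} (hf : MemLp f 2 (μ.prod ν)) {R : ℝ} (hR : ∀ y x, R < ‖x‖ → f (y, x) = 0) :
    ∀ᵐ y ∂μ, Integrable (fun x => f (y, x)) ν ∧ MemLp (fun x => f (y, x)) 2 ν := by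
  have h1 := (memLp_two_iff hf.1).1 hf
  rw [lintegral_prod _ (hf.1.enorm.pow_const 2)] at h1
  have h2 := ae_lt_top' (hf.1.enorm.pow_const 2).lintegral_prod_right' h1.ne
  filter_upwards [h2, hf.1.prodMk_left] with y hy hm
  have hM : MemLp (fun x => f (y, x)) 2 ν := (memLp_two_iff hm).2 hy
  refine ⟨?_, hM⟩
  have : IntegrableOn (fun x => f (y, x)) (Metric.closedBall 0 R) ν := by
    have : IsFiniteMeasure (ν.restrict (Metric.closedBall (0 : V) R)) :=
      ⟨by simpa using (isCompact_closedBall (0 : V) R).measure_lt_top⟩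
    exact (hM.restrict _).integrable (by norm_num)
  refine (integrableOn_iff_integrable_of_support_subset fun x hx => ?_).1 this
  rw [mem_closedBall_zero_iff]
  by_contra h
  exact hx (hR y x (not_le.1 h))

theorem norm_cexp_eq_one {z : ℂ} (hz : z.re = 0) : ‖Complex.exp z‖ = 1 := by
  rw [Complex.norm_exp, hz, Real.exp_zero]

theorem integrable_mul_cexp {X : Type*} [MeasurableSpace X] {μ : Measure X} {f : X → ℂ}
    (hf : Integrable f μ) {u : X → ℂ} (hu : AEStronglyMeasurable u μ) (hr : ∀ x, (u x).re = 0) :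
    Integrable (fun x => f x * Complex.exp (u x)) μ := by
  refine hf.mul_bdd (c := 1) (Complex.continuous_exp.comp_aestronglyMeasurable hu) ?_
  exact Eventually.of_forall fun x => (norm_cexp_eq_one (hr x)).le

/-! ### The Fourier transform in the central variable -/

/-- The integral `∫ f(z,t) e^{2πiλt} dt`, as a function of `(z, λ)`. -/
def centralInt (f : (EucSp n × EucSp n) × ℝ → ℂ) (q : (EucSp n × EucSp n) × ℝ) : ℂ :=
  ∫ t : ℝ, f (q.1, t) * Complex.exp (2 * Real.pi * q.2 * t * Complex.I)

theorem centralInt_congr {f g : (EucSp n × EucSp n) × ℝ → ℂ} (h : f =ᵐ[volume] g) :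
    centralInt f =ᵐ[volume] centralInt g := by
  have h1 : ∀ᵐ z : EucSp n × EucSp n, ∀ᵐ t : ℝ, f (z, t) = g (z, t) :=
    Measure.ae_ae_of_ae_prod h
  have h2 := (Measure.quasiMeasurePreserving_fst (μ := (volume : Measure (EucSp n × EucSp n)))
    (ν := (volume : Measure ℝ))).ae h1
  filter_upwards [h2] with q hq
  refine integral_congr_ae ?_
  filter_upwards [hq] with t ht
  rw [ht]

theorem stronglyMeasurable_centralInt {f : (EucSp n × EucSp n) × ℝ → ℂ}
    (hf : StronglyMeasurable f) : StronglyMeasurable (centralInt f) := by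
  refine StronglyMeasurable.integral_prod_right' (f := fun p : ((EucSp n × EucSp n) × ℝ) × ℝ =>
    f (p.1.1, p.2) * Complex.exp (2 * Real.pi * p.1.2 * p.2 * Complex.I)) ?_
  refine (hf.comp_measurable (by fun_prop)).mul (Continuous.stronglyMeasurable (by fun_prop))

/-- Existence of the isometric extension to `L²` of `centralInt`, which computes `f^λ` in the sense
of `IsFourierT`. -/
theorem exists_centralFourier (n : ℕ) :
    ∃ U : Lp ℂ 2 (volume : Measure ((EucSp n × EucSp n) × ℝ)) →L[ℂ]
        Lp ℂ 2 (volume : Measure ((EucSp n × EucSp n) × ℝ)),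
      (∀ f, ‖U f‖ = ‖f‖) ∧
      (∀ f (hf : MemLp f 2 volume) (N : ℕ), (∀ q, (N : ℝ) < ‖q.2‖ → f q = 0) →
        U (hf.toLp f) =ᵐ[volume] centralInt f) ∧
      ∀ f, IsFourierT f (U f) := by
  have hadd : ∀ (f g : (EucSp n × EucSp n) × ℝ → ℂ) (N : ℕ), MemLp f 2 volume → MemLp g 2 volume →
      (∀ q, q ∉ {q : (EucSp n × EucSp n) × ℝ | ‖q.2‖ ≤ N} → f q = 0) →
      (∀ q, q ∉ {q : (EucSp n × EucSp n) × ℝ | ‖q.2‖ ≤ N} → g q = 0) →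
      centralInt (f + g) =ᵐ[volume] centralInt f + centralInt g := by
    intro f g N hf hg hfs hgs
    have a1 := ae_integrable_memLp_fibre (R := N) (μ := (volume : Measure (EucSp n × EucSp n)))
      (ν := (volume : Measure ℝ)) hf (fun y x hx => hfs _ (not_le.2 hx))
    have a2 := ae_integrable_memLp_fibre (R := N) (μ := (volume : Measure (EucSp n × EucSp n)))
      (ν := (volume : Measure ℝ)) hg (fun y x hx => hgs _ (not_le.2 hx))
    have a3 := (Measure.quasiMeasurePreserving_fst (μ := (volume : Measure (EucSp n × EucSp n)))
      (ν := (volume : Measure ℝ))).ae (a1.and a2)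
    filter_upwards [a3] with q hq
    simp only [centralInt, Pi.add_apply, add_mul]
    refine integral_add ?_ ?_
    · exact integrable_mul_cexp hq.1.1 (Continuous.aestronglyMeasurable (by fun_prop)) (by simp)
    · exact integrable_mul_cexp hq.2.1 (Continuous.aestronglyMeasurable (by fun_prop)) (by simp)
  have hsmul : ∀ (a : ℂ) (f : (EucSp n × EucSp n) × ℝ → ℂ),
      centralInt (a • f) = a • centralInt f := by
    intro a f
    funext q
    simp only [centralInt, Pi.smul_apply, smul_eq_mul, mul_assoc]
    exact integral_const_mul _ _
  have hnorm : ∀ (f : (EucSp n × EucSp n) × ℝ → ℂ) (N : ℕ), MemLp f 2 volume →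
      (∀ q, q ∉ {q : (EucSp n × EucSp n) × ℝ | ‖q.2‖ ≤ N} → f q = 0) →
      eLpNorm (centralInt f) 2 volume = ENNReal.ofReal 1 * eLpNorm f 2 volume := by
    intro f N hf hs
    refine eLpNorm_eq_mul_of_lintegral_sq zero_le_one ?_
    have a1 := ae_integrable_memLp_fibre (R := N) (μ := (volume : Measure (EucSp n × EucSp n)))
      (ν := (volume : Measure ℝ)) hf (fun y x hx => hs _ (not_le.2 hx))
    have am : AEStronglyMeasurable (centralInt f) volume :=
      (stronglyMeasurable_centralInt hf.1.stronglyMeasurable_mk).aestronglyMeasurable.congr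
      (centralInt_congr hf.1.ae_eq_mk.symm)
    rw [Measure.volume_eq_prod, lintegral_prod _ (am.enorm.pow_const 2),
      lintegral_prod _ (hf.1.enorm.pow_const 2)]
    simp only [one_pow, ENNReal.ofReal_one, one_mul]
    refine lintegral_congr_ae ?_
    filter_upwards [a1] with z hz
    rw [← lintegral_fourierInt_sq hz.1 hz.2]
    refine lintegral_congr fun w => ?_
    simp only [centralInt]
    congr 3
    funext t
    simp [mul_assoc]
  have key := exists_L2_extension
    (μ := (volume : Measure ((EucSp n × EucSp n) × ℝ)))
    (ν := (volume : Measure ((EucSp n × EucSp n) × ℝ)))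
    (A := fun N => {q | ‖q.2‖ ≤ N}) (c := 1) (T := centralInt)
    (fun N => measurableSet_le (by fun_prop) (by fun_prop))
    (fun N M h q hq => le_trans (α := ℝ) hq (Nat.cast_le.2 h))
    (fun q => exists_nat_ge ‖q.2‖) zero_le_one
    (fun f hf => (stronglyMeasurable_centralInt hf.stronglyMeasurable_mk).aestronglyMeasurable.congr
      (centralInt_congr hf.ae_eq_mk.symm))
    (fun f g _ _ h => centralInt_congr h)
  obtain ⟨U, h1, h2, h3⟩ := key hadd hsmul hnorm
  refine ⟨U, fun f => by simpa using h1 f, fun f hf N hs => h2 f hf N fun q hq =>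
    hs q (not_le.1 hq), fun f => ⟨Lp.memLp _, (h3 f).congr fun N => ?_⟩⟩
  congr 1
  funext q
  congr 1
  rw [centralInt, ← integral_indicator measurableSet_Icc]
  congr 1
  funext t
  by_cases h : t ∈ Set.Icc (-(N : ℝ)) N
  · rw [Set.indicator_of_mem h, Set.indicator_of_mem]
    exact abs_le.2 h
  · rw [Set.indicator_of_notMem h, Set.indicator_of_notMem, zero_mul]
    exact fun h' => h (abs_le.1 h')

/-- The Fourier transform in the central variable on `L²`. -/
def centralFourier (n : ℕ) : Lp ℂ 2 (volume : Measure ((EucSp n × EucSp n) × ℝ)) →L[ℂ]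
    Lp ℂ 2 (volume : Measure ((EucSp n × EucSp n) × ℝ)) :=
  (exists_centralFourier n).choose

theorem norm_centralFourier (f : L2Heis n) : ‖centralFourier n f‖ = ‖f‖ :=
  (exists_centralFourier n).choose_spec.1 f

theorem centralFourier_toLp {f : (EucSp n × EucSp n) × ℝ → ℂ} (hf : MemLp f 2 volume) (N : ℕ)
    (hs : ∀ q, (N : ℝ) < ‖q.2‖ → f q = 0) :
    centralFourier n (hf.toLp f) =ᵐ[volume] centralInt f :=
  (exists_centralFourier n).choose_spec.2.1 f hf N hs

theorem isFourierT_centralFourier (f : L2Heis n) : IsFourierT f (centralFourier n f) :=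
  (exists_centralFourier n).choose_spec.2.2 f

theorem inner_centralFourier (f g : L2Heis n) :
    inner ℂ (centralFourier n f) (centralFourier n g) = inner ℂ f g :=
  LinearIsometry.inner_map_map ⟨(centralFourier n).toLinearMap, norm_centralFourier⟩ f g

/-- The `L²` limit defining `f^λ` is unique. -/
theorem isFourierT_unique {f : L2Heis n} {F F' : (EucSp n × EucSp n) × ℝ → ℂ}
    (h : IsFourierT f F) (h' : IsFourierT f F') : F =ᵐ[volume] F' := by
  have hm : ∀ N : ℕ, AEStronglyMeasurable (fun q : (EucSp n × EucSp n) × ℝ =>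
      ∫ t in Set.Icc (-(N : ℝ)) N,
        f (q.1, t) * Complex.exp (2 * Real.pi * q.2 * t * Complex.I)) volume := fun N => by
    refine (StronglyMeasurable.integral_prod_right'
      (f := fun p : ((EucSp n × EucSp n) × ℝ) × ℝ =>
      f (p.1.1, p.2) * Complex.exp (2 * Real.pi * p.1.2 * p.2 * Complex.I)) ?_).aestronglyMeasurable
    exact ((Lp.stronglyMeasurable f).comp_measurable (by fun_prop)).mul
      (Continuous.stronglyMeasurable (by fun_prop))
  have h0 : eLpNorm (F - F') 2 volume = 0 := by
    refine le_antisymm (ge_of_tendsto' (x := atTop)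
      (by simpa using h.tendsto.add h'.tendsto) fun N => ?_) zero_le
    refine (eLpNorm_congr_ae (Eventually.of_forall fun q => ?_)).le.trans
      (eLpNorm_sub_le (h.memLp.1.sub (hm N)) (h'.memLp.1.sub (hm N)) (by norm_num))
    simp
  rw [eLpNorm_eq_zero_iff (h.memLp.1.sub h'.memLp.1) two_ne_zero] at h0
  filter_upwards [h0] with q hq
  exact sub_eq_zero.1 hq

/-- The functions `f^λ` are, for almost every `λ`, the slices of the central Fourier transform. -/
theorem fourierT_ae_eq (f : L2Heis n) :
    ∀ᵐ lam : ℝ, fourierT f lam =ᵐ[volume] fun z => centralFourier n f (z, lam) := by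
  have hex : ∃ F, IsFourierT f F := ⟨_, isFourierT_centralFourier f⟩
  have h1 := isFourierT_unique hex.choose_spec (isFourierT_centralFourier f)
  have h2 : ∀ᵐ p : ℝ × (EucSp n × EucSp n), hex.choose p.swap = centralFourier n f p.swap :=
    (Measure.measurePreserving_swap (μ := (volume : Measure ℝ))
      (ν := (volume : Measure (EucSp n × EucSp n)))).quasiMeasurePreserving.ae h1
  have h3 := Measure.ae_ae_of_ae_prod h2
  filter_upwards [h3] with lam hl
  filter_upwards [hl] with z hz
  rw [fourierT, dif_pos hex]
  exact hz

/-! ### The kernel of the Weyl transform -/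

/-- The integral `∫ g(x, η-ξ) e^{iπλ x·(ξ+η)} dx` defining the kernel of the Weyl transform, as a
function of `(ξ, η)`. -/
def weylInt (lam : ℝ) (g : EucSp n × EucSp n → ℂ) (q : EucSp n × EucSp n) : ℂ :=
  ∫ x, g (x, q.2 - q.1) *
    Complex.exp (Real.pi * lam * ((inner ℝ x (q.1 + q.2) : ℝ) : ℂ) * Complex.I)

theorem ae_sub_of_ae {p : EucSp n → Prop} (h : ∀ᵐ y, p y) :
    ∀ᵐ q : EucSp n × EucSp n, p (q.2 - q.1) := by
  have h1 := (measurePreserving_prod_neg_add (volume : Measure (EucSp n))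
    (volume : Measure (EucSp n)))
  have h2 := (Measure.quasiMeasurePreserving_snd (μ := (volume : Measure (EucSp n)))
      (ν := (volume : Measure (EucSp n)))).ae h
  filter_upwards [h1.quasiMeasurePreserving.ae h2] with q hq
  rwa [sub_eq_neg_add]

theorem ae_ae_swap {p : EucSp n × EucSp n → Prop} (h : ∀ᵐ q, p q) :
    ∀ᵐ y : EucSp n, ∀ᵐ x : EucSp n, p (x, y) := by
  have h1 := (Measure.measurePreserving_swap (μ := (volume : Measure (EucSp n)))
    (ν := (volume : Measure (EucSp n)))).quasiMeasurePreserving.ae h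
  exact Measure.ae_ae_of_ae_prod h1

theorem weylInt_congr (lam : ℝ) {f g : EucSp n × EucSp n → ℂ} (h : f =ᵐ[volume] g) :
    weylInt lam f =ᵐ[volume] weylInt lam g := by
  filter_upwards [ae_sub_of_ae (ae_ae_swap h)] with q hq
  refine integral_congr_ae ?_
  filter_upwards [hq] with t ht
  rw [ht]

theorem stronglyMeasurable_weylInt (lam : ℝ) {f : EucSp n × EucSp n → ℂ}
    (hf : StronglyMeasurable f) : StronglyMeasurable (weylInt lam f) := by
  refine StronglyMeasurable.integral_prod_right'
    (f := fun p : (EucSp n × EucSp n) × EucSp n => f (p.2, p.1.2 - p.1.1) *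
      Complex.exp (Real.pi * lam * ((inner ℝ p.2 (p.1.1 + p.1.2) : ℝ) : ℂ) * Complex.I)) ?_
  refine (hf.comp_measurable ?_).mul (Continuous.stronglyMeasurable (by fun_prop))
  exact Continuous.measurable (by fun_prop)

theorem aestronglyMeasurable_weylInt (lam : ℝ) {f : EucSp n × EucSp n → ℂ}
    (hf : AEStronglyMeasurable f volume) : AEStronglyMeasurable (weylInt lam f) volume :=
  (stronglyMeasurable_weylInt lam hf.stronglyMeasurable_mk).aestronglyMeasurable.congr
    (weylInt_congr lam hf.ae_eq_mk.symm)

theorem ae_integrable_memLp_slice {f : EucSp n × EucSp n → ℂ} (hf : MemLp f 2 volume) {R : ℝ}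
    (hR : ∀ q : EucSp n × EucSp n, R < ‖q.1‖ → f q = 0) :
    ∀ᵐ y : EucSp n, Integrable (fun x => f (x, y)) ∧ MemLp (fun x => f (x, y)) 2 := by
  have h1 := (Measure.measurePreserving_swap (μ := (volume : Measure (EucSp n)))
    (ν := (volume : Measure (EucSp n))))
  exact ae_integrable_memLp_fibre (μ := (volume : Measure (EucSp n)))
    (ν := (volume : Measure (EucSp n))) (hf.comp_measurePreserving h1) (R := R)
    (fun y x hx => hR (x, y) hx)

theorem lintegral_comp_smul_add (lam : ℝ) (hlam : lam ≠ 0) (v : EucSp n) (h : EucSp n → ENNReal) :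
    ∫⁻ ξ, h (lam • ξ + v) = ENNReal.ofReal ((|lam| ^ n)⁻¹) * ∫⁻ w, h w := by
  have e1 : ∫⁻ ξ, h (lam • ξ + v) = ∫⁻ ξ, (fun w => h (w + v)) (lam • ξ) := rfl
  rw [e1, ← lintegral_add_right_eq_self h v]
  have hemb : MeasurableEmbedding (fun ξ : EucSp n => lam • ξ) :=
    (Homeomorph.smulOfNeZero lam hlam).measurableEmbedding
  rw [← hemb.lintegral_map (fun w => h (w + v)), Measure.map_addHaar_smul volume hlam,
    lintegral_smul_measure]
  simp [abs_inv, abs_pow]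

/-- Plancherel's theorem for the kernel of the Weyl transform. -/
theorem lintegral_weylInt_sq {lam : ℝ} (hlam : lam ≠ 0) {f : EucSp n × EucSp n → ℂ}
    (hf : MemLp f 2 volume) {R : ℝ} (hR : ∀ q : EucSp n × EucSp n, R < ‖q.1‖ → f q = 0) :
    ∫⁻ q, ‖weylInt lam f q‖ₑ ^ 2 = ENNReal.ofReal ((|lam| ^ n)⁻¹) * ∫⁻ q, ‖f q‖ₑ ^ 2 := by
  have am := (aestronglyMeasurable_weylInt lam hf.1).enorm.pow_const 2
  have h1 := measurePreserving_prod_add (volume : Measure (EucSp n)) (volume : Measure (EucSp n))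
  -- In the variables `y = η - ξ` and `ξ`, the function `weylInt lam f` is the Fourier transform of
  -- `f(·, y)` at `λξ + (λ/2)y`.
  have h2 : ∫⁻ q, ‖weylInt lam f q‖ₑ ^ 2 =
      ∫⁻ q : EucSp n × EucSp n, ‖weylInt lam f (q.1, q.1 + q.2)‖ₑ ^ 2 := by
    rw [Measure.volume_eq_prod] at am ⊢
    conv_lhs => rw [← h1.map_eq]
    rw [lintegral_map' (by rw [h1.map_eq]; exact am) h1.aemeasurable]
  have am2 : AEMeasurable (fun q : EucSp n × EucSp n =>
      ‖weylInt lam f (q.1, q.1 + q.2)‖ₑ ^ 2) (volume.prod volume) :=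
    AEMeasurable.comp_quasiMeasurePreserving (g := fun q => ‖weylInt lam f q‖ₑ ^ 2) am
      h1.quasiMeasurePreserving
  rw [h2, Measure.volume_eq_prod, lintegral_prod_symm _ am2,
    lintegral_prod_symm _ (hf.1.enorm.pow_const 2),
    ← lintegral_const_mul' _ _ ENNReal.ofReal_ne_top]
  refine lintegral_congr_ae ?_
  filter_upwards [ae_integrable_memLp_slice hf hR] with y hy
  rw [← lintegral_fourierInt_sq hy.1 hy.2,
    ← lintegral_comp_smul_add lam hlam ((lam / 2) • y)]
  refine lintegral_congr fun ξ => ?_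
  simp only [weylInt, add_sub_cancel_left]
  congr 3
  funext x
  congr 2
  simp only [inner_add_right, inner_smul_right]
  push_cast
  ring

theorem inner_eq_polarization {H : Type*} [NormedAddCommGroup H] [InnerProductSpace ℂ H]
    (x y : H) : inner ℂ x y = (((‖x + y‖ ^ 2 - ‖x - y‖ ^ 2 : ℝ) : ℂ) +
      ((‖x - Complex.I • y‖ ^ 2 - ‖x + Complex.I • y‖ ^ 2 : ℝ) : ℂ) * Complex.I) / 4 := by
  rw [inner_eq_sum_norm_sq_div_four]
  simp

/-- Existence of the extension to `L²` of `weylInt`, which computes the kernel of the Weyl transform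
in the sense of `IsWeylKernel`. -/
theorem exists_weylFourier {lam : ℝ} (hlam : lam ≠ 0) :
    ∃ U : Lp ℂ 2 (volume : Measure (EucSp n × EucSp n)) →L[ℂ]
        Lp ℂ 2 (volume : Measure (EucSp n × EucSp n)),
      (∀ f, ‖U f‖ = √((|lam| ^ n)⁻¹) * ‖f‖) ∧
      (∀ f (hf : MemLp f 2 volume) (N : ℕ), (∀ q, (N : ℝ) < ‖q.1‖ → f q = 0) →
        U (hf.toLp f) =ᵐ[volume] weylInt lam f) ∧
      ∀ f : Lp ℂ 2 (volume : Measure (EucSp n × EucSp n)), IsWeylKernel lam f (U f) := by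
  have hadd : ∀ (f g : EucSp n × EucSp n → ℂ) (N : ℕ), MemLp f 2 volume → MemLp g 2 volume →
      (∀ q, q ∉ {q : EucSp n × EucSp n | ‖q.1‖ ≤ N} → f q = 0) →
      (∀ q, q ∉ {q : EucSp n × EucSp n | ‖q.1‖ ≤ N} → g q = 0) →
      weylInt lam (f + g) =ᵐ[volume] weylInt lam f + weylInt lam g := by
    intro f g N hf hg hfs hgs
    have a1 := ae_integrable_memLp_slice (R := N) hf (fun q hx => hfs _ (not_le.2 hx))
    have a2 := ae_integrable_memLp_slice (R := N) hg (fun q hx => hgs _ (not_le.2 hx))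
    filter_upwards [ae_sub_of_ae (a1.and a2)] with q hq
    simp only [weylInt, Pi.add_apply, add_mul]
    refine integral_add ?_ ?_
    · exact integrable_mul_cexp hq.1.1 (Continuous.aestronglyMeasurable (by fun_prop)) (by simp)
    · exact integrable_mul_cexp hq.2.1 (Continuous.aestronglyMeasurable (by fun_prop)) (by simp)
  have hsmul : ∀ (a : ℂ) (f : EucSp n × EucSp n → ℂ),
      weylInt lam (a • f) = a • weylInt lam f := by
    intro a f
    funext q
    simp only [weylInt, Pi.smul_apply, smul_eq_mul, mul_assoc]
    exact integral_const_mul _ _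
  have hnorm : ∀ (f : EucSp n × EucSp n → ℂ) (N : ℕ), MemLp f 2 volume →
      (∀ q, q ∉ {q : EucSp n × EucSp n | ‖q.1‖ ≤ N} → f q = 0) →
      eLpNorm (weylInt lam f) 2 volume =
        ENNReal.ofReal (√((|lam| ^ n)⁻¹)) * eLpNorm f 2 volume := by
    intro f N hf hs
    refine eLpNorm_eq_mul_of_lintegral_sq (Real.sqrt_nonneg _) ?_
    rw [Real.sq_sqrt (by positivity)]
    exact lintegral_weylInt_sq hlam hf (R := N) (fun q hx => hs _ (not_le.2 hx))
  have key := exists_L2_extension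
    (μ := (volume : Measure (EucSp n × EucSp n)))
    (ν := (volume : Measure (EucSp n × EucSp n)))
    (A := fun N => {q | ‖q.1‖ ≤ N}) (c := √((|lam| ^ n)⁻¹)) (T := weylInt lam)
    (fun N => measurableSet_le (by fun_prop) (by fun_prop))
    (fun N M h q hq => le_trans (α := ℝ) hq (Nat.cast_le.2 h))
    (fun q => exists_nat_ge ‖q.1‖) (Real.sqrt_nonneg _)
    (fun f hf => aestronglyMeasurable_weylInt lam hf)
    (fun f g _ _ h => weylInt_congr lam h)
  obtain ⟨U, h1, h2, h3⟩ := key hadd hsmul hnorm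
  refine ⟨U, h1, fun f hf N hs => h2 f hf N fun q hq =>
    hs q (not_le.1 hq), fun f => ⟨Lp.memLp _, (h3 f).congr fun N => ?_⟩⟩
  congr 1
  funext q
  congr 1
  rw [weylInt, ← integral_indicator Metric.isClosed_closedBall.measurableSet]
  congr 1
  funext t
  by_cases h : t ∈ Metric.closedBall (0 : EucSp n) N
  · rw [Set.indicator_of_mem h, Set.indicator_of_mem]
    exact mem_closedBall_zero_iff.1 h
  · rw [Set.indicator_of_notMem h, Set.indicator_of_notMem, zero_mul]
    exact fun h' => h (mem_closedBall_zero_iff.2 h')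

open Classical in
/-- The map taking `g ∈ L²(ℂⁿ)` to the kernel of its Weyl transform; zero for `λ = 0`. -/
def weylFourier (lam : ℝ) : Lp ℂ 2 (volume : Measure (EucSp n × EucSp n)) →L[ℂ]
    Lp ℂ 2 (volume : Measure (EucSp n × EucSp n)) :=
  if h : lam ≠ 0 then (exists_weylFourier h).choose else 0

theorem weylFourier_spec {lam : ℝ} (hlam : lam ≠ 0) :
    (∀ f, ‖weylFourier (n := n) lam f‖ = √((|lam| ^ n)⁻¹) * ‖f‖) ∧
      (∀ f (hf : MemLp f 2 volume) (N : ℕ), (∀ q, (N : ℝ) < ‖q.1‖ → f q = 0) →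
        weylFourier (n := n) lam (hf.toLp f) =ᵐ[volume] weylInt lam f) ∧
      ∀ f : Lp ℂ 2 (volume : Measure (EucSp n × EucSp n)),
        IsWeylKernel lam f (weylFourier lam f) := by
  have : weylFourier (n := n) lam = (exists_weylFourier hlam).choose := by
    rw [weylFourier, dif_pos hlam]
  rw [this]
  exact (exists_weylFourier hlam).choose_spec

theorem norm_weylFourier_sq {lam : ℝ} (hlam : lam ≠ 0)
    (f : Lp ℂ 2 (volume : Measure (EucSp n × EucSp n))) :
    ‖weylFourier lam f‖ ^ 2 * |lam| ^ n = ‖f‖ ^ 2 := by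
  rw [(weylFourier_spec hlam).1, mul_pow, Real.sq_sqrt (by positivity)]
  have : |lam| ^ n ≠ 0 := by positivity
  field_simp

theorem inner_weylFourier {lam : ℝ} (hlam : lam ≠ 0)
    (f g : Lp ℂ 2 (volume : Measure (EucSp n × EucSp n))) :
    inner ℂ (weylFourier lam f) (weylFourier lam g) * ((|lam| ^ n : ℝ) : ℂ) = inner ℂ f g := by
  rw [inner_eq_polarization, inner_eq_polarization f g]
  simp only [← map_add, ← map_sub, ← map_smul]
  rw [← norm_weylFourier_sq hlam (f + g), ← norm_weylFourier_sq hlam (f - g),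
    ← norm_weylFourier_sq hlam (f - Complex.I • g), ← norm_weylFourier_sq hlam (f + Complex.I • g)]
  push_cast
  ring

theorem isWeylKernel_congr {lam : ℝ} {f g K : EucSp n × EucSp n → ℂ} (h : f =ᵐ[volume] g)
    (hK : IsWeylKernel lam f K) : IsWeylKernel lam g K := by
  refine ⟨hK.memLp, hK.tendsto.congr fun N => eLpNorm_congr_ae ?_⟩
  filter_upwards [ae_sub_of_ae (ae_ae_swap h)] with q hq
  congr 1
  refine integral_congr_ae (ae_restrict_of_ae ?_)
  filter_upwards [hq] with t ht
  rw [ht]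

theorem isWeylKernel_unique {lam : ℝ} {f : Lp ℂ 2 (volume : Measure (EucSp n × EucSp n))}
    {K K' : EucSp n × EucSp n → ℂ} (h : IsWeylKernel lam f K) (h' : IsWeylKernel lam f K') :
    K =ᵐ[volume] K' := by
  have hm : ∀ N : ℕ, AEStronglyMeasurable (fun q : EucSp n × EucSp n =>
      ∫ x in Metric.closedBall (0 : EucSp n) (N : ℝ), f (x, q.2 - q.1) *
        Complex.exp (Real.pi * lam * ((inner ℝ x (q.1 + q.2) : ℝ) : ℂ) * Complex.I))
      volume := fun N => by
    refine (StronglyMeasurable.integral_prod_right'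
      (f := fun p : (EucSp n × EucSp n) × EucSp n => f (p.2, p.1.2 - p.1.1) *
        Complex.exp (Real.pi * lam * ((inner ℝ p.2 (p.1.1 + p.1.2) : ℝ) : ℂ) * Complex.I))
      ?_).aestronglyMeasurable
    exact ((Lp.stronglyMeasurable f).comp_measurable (Continuous.measurable (by fun_prop))).mul
      (Continuous.stronglyMeasurable (by fun_prop))
  have h0 : eLpNorm (K - K') 2 volume = 0 := by
    refine le_antisymm (ge_of_tendsto' (x := atTop)
      (by simpa using h.tendsto.add h'.tendsto) fun N => ?_) zero_le
    refine (eLpNorm_congr_ae (Eventually.of_forall fun q => ?_)).le.trans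
      (eLpNorm_sub_le (h.memLp.1.sub (hm N)) (h'.memLp.1.sub (hm N)) (by norm_num))
    simp
  rw [eLpNorm_eq_zero_iff (h.memLp.1.sub h'.memLp.1) two_ne_zero] at h0
  filter_upwards [h0] with q hq
  exact sub_eq_zero.1 hq

/-- The kernel of the Weyl transform is computed by `weylFourier`, for any representative of a class
in `L²`. -/
theorem weylKernel_ae_eq {lam : ℝ} (hlam : lam ≠ 0) {g : EucSp n × EucSp n → ℂ}
    {f : Lp ℂ 2 (volume : Measure (EucSp n × EucSp n))} (h : g =ᵐ[volume] f) :
    (fun q : EucSp n × EucSp n => weylKernel lam g q.1 q.2) =ᵐ[volume] weylFourier lam f := by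
  have hf := (weylFourier_spec hlam).2.2 f
  have hex : ∃ K, IsWeylKernel lam g K := ⟨_, isWeylKernel_congr h.symm hf⟩
  filter_upwards [isWeylKernel_unique (isWeylKernel_congr h hex.choose_spec) hf] with q hq
  rw [weylKernel, dif_pos hex]
  exact hq

/-! ### Hilbert–Schmidt operators with `L²` kernels -/

theorem lintegral_volume_prod {X Y : Type*} [MeasureSpace X] [MeasureSpace Y]
    [SFinite (volume : Measure Y)] {f : X × Y → ENNReal} (hf : AEMeasurable f volume) :
    ∫⁻ q, f q = ∫⁻ x, ∫⁻ y, f (x, y) := lintegral_prod f hf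

theorem integral_volume_prod {X Y : Type*} [MeasureSpace X] [MeasureSpace Y]
    [SFinite (volume : Measure X)] [SFinite (volume : Measure Y)] {f : X × Y → ℂ}
    (hf : Integrable f) : ∫ q, f q = ∫ x, ∫ y, f (x, y) := integral_prod f hf

theorem integrable_mul_of_memLp_two {X : Type*} [MeasurableSpace X] {μ : Measure X} {f g : X → ℂ}
    (hf : MemLp f 2 μ) (hg : MemLp g 2 μ) : Integrable (fun x => f x * g x) μ :=
  MemLp.integrable_mul hf hg

theorem enorm_integral_mul_sq_le {X : Type*} [MeasurableSpace X] {μ : Measure X} {f g : X → ℂ}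
    (hf : AEStronglyMeasurable f μ) (hg : AEStronglyMeasurable g μ) :
    ‖∫ x, f x * g x ∂μ‖ₑ ^ 2 ≤ (∫⁻ x, ‖f x‖ₑ ^ 2 ∂μ) * ∫⁻ x, ‖g x‖ₑ ^ 2 ∂μ := by
  have h1 : ‖∫ x, f x * g x ∂μ‖ₑ ≤ ∫⁻ x, ‖f x‖ₑ * ‖g x‖ₑ ∂μ :=
    (enorm_integral_le_lintegral_enorm _).trans (by simp_rw [enorm_mul]; exact le_rfl)
  have h2 := ENNReal.lintegral_mul_le_Lp_mul_Lq μ Real.HolderConjugate.two_two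
    hf.enorm hg.enorm
  calc _ ≤ _ := pow_le_pow_left' (h1.trans h2) 2
    _ = _ := by
      rw [mul_pow, ← ENNReal.rpow_natCast, ← ENNReal.rpow_natCast, ← ENNReal.rpow_mul,
        ← ENNReal.rpow_mul]
      norm_num

/-- The function `ξ ↦ ∫ K(ξ,η) ψ(η) dη`. -/
def kernelFun (K : EucSp n × EucSp n → ℂ) (ψ : EucSp n → ℂ) (ξ : EucSp n) : ℂ :=
  ∫ η, K (ξ, η) * ψ η

theorem memLp_kernelFun (K : Lp ℂ 2 (volume : Measure (EucSp n × EucSp n))) (ψ : L2Euc n) :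
    MemLp (kernelFun K ψ) 2 volume ∧
      ∫⁻ ξ, ‖kernelFun K ψ ξ‖ₑ ^ 2 ≤ ‖K‖ₑ ^ 2 * ‖ψ‖ₑ ^ 2 := by
  have hK := Lp.stronglyMeasurable K
  have hψ := Lp.stronglyMeasurable ψ
  have hb : ∫⁻ ξ, ‖kernelFun K ψ ξ‖ₑ ^ 2 ≤ ‖K‖ₑ ^ 2 * ‖ψ‖ₑ ^ 2 := by
    calc ∫⁻ ξ, ‖kernelFun K ψ ξ‖ₑ ^ 2
        ≤ ∫⁻ ξ, (∫⁻ η, ‖K (ξ, η)‖ₑ ^ 2) * ∫⁻ η, ‖ψ η‖ₑ ^ 2 :=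
          lintegral_mono fun ξ => enorm_integral_mul_sq_le
            (hK.comp_measurable measurable_prodMk_left).aestronglyMeasurable
            hψ.aestronglyMeasurable
      _ = _ := by
          rw [lintegral_mul_const' _ _ (by rw [← enorm_sq_eq_lintegral]; simp),
            enorm_sq_eq_lintegral, enorm_sq_eq_lintegral,
            lintegral_volume_prod (hK.enorm.pow_const 2).aemeasurable]
  have hm : StronglyMeasurable (kernelFun K ψ) := by
    refine StronglyMeasurable.integral_prod_right' (f := fun q : EucSp n × EucSp n =>
      K q * ψ q.2) ?_
    exact hK.mul (hψ.comp_measurable measurable_snd)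
  refine ⟨(memLp_two_iff hm.aestronglyMeasurable).2 (hb.trans_lt ?_), hb⟩
  exact ENNReal.mul_lt_top (by simp) (by simp)

theorem ae_memLp_section {K : EucSp n × EucSp n → ℂ} (hK : MemLp K 2 volume) :
    ∀ᵐ ξ : EucSp n, MemLp (fun η => K (ξ, η)) 2 := by
  have h1 := (memLp_two_iff hK.1).1 hK
  rw [Measure.volume_eq_prod, lintegral_prod _ (hK.1.enorm.pow_const 2)] at h1
  have h2 := ae_lt_top' (AEMeasurable.lintegral_prod_right' (hK.1.enorm.pow_const 2)) h1.ne
  filter_upwards [h2, AEStronglyMeasurable.prodMk_left hK.1] with y hy hm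
  exact (memLp_two_iff hm).2 hy

/-- The operator `ψ ↦ ∫ K(·,η) ψ(η) dη` on `L²(ℝⁿ)` with kernel `K ∈ L²`. -/
def kernelOp (n : ℕ) :
    Lp ℂ 2 (volume : Measure (EucSp n × EucSp n)) →L[ℂ] L2Euc n →L[ℂ] L2Euc n :=
  LinearMap.mkContinuous₂
    (LinearMap.mk₂ ℂ (fun K ψ => (memLp_kernelFun K ψ).1.toLp _)
      (fun K K' ψ => by
        rw [← MemLp.toLp_add, MemLp.toLp_eq_toLp_iff]
        have h := Measure.ae_ae_of_ae_prod (Lp.coeFn_add K K')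
        filter_upwards [h, ae_memLp_section (Lp.memLp K), ae_memLp_section (Lp.memLp K')]
          with ξ h1 h2 h3
        simp only [kernelFun, Pi.add_apply]
        rw [← integral_add (integrable_mul_of_memLp_two h2 (Lp.memLp ψ))
          (integrable_mul_of_memLp_two h3 (Lp.memLp ψ))]
        refine integral_congr_ae ?_
        filter_upwards [h1] with η h4
        simp only [Pi.add_apply] at h4
        simp only [h4, add_mul])
      (fun a K ψ => by
        rw [← MemLp.toLp_const_smul, MemLp.toLp_eq_toLp_iff]
        have h := Measure.ae_ae_of_ae_prod (Lp.coeFn_smul a K)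
        filter_upwards [h] with ξ h1
        simp only [kernelFun, Pi.smul_apply]
        rw [← integral_smul]
        refine integral_congr_ae ?_
        filter_upwards [h1] with η h4
        simp only [Pi.smul_apply] at h4
        simp only [h4, smul_eq_mul, mul_assoc])
      (fun K ψ ψ' => by
        rw [← MemLp.toLp_add, MemLp.toLp_eq_toLp_iff]
        filter_upwards [ae_memLp_section (Lp.memLp K)] with ξ h2
        simp only [kernelFun, Pi.add_apply]
        rw [← integral_add (integrable_mul_of_memLp_two h2 (Lp.memLp ψ))
          (integrable_mul_of_memLp_two h2 (Lp.memLp ψ'))]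
        refine integral_congr_ae ?_
        filter_upwards [Lp.coeFn_add ψ ψ'] with η h4
        simp only [Pi.add_apply] at h4
        simp only [h4, mul_add])
      (fun a K ψ => by
        rw [← MemLp.toLp_const_smul, MemLp.toLp_eq_toLp_iff]
        refine Eventually.of_forall fun ξ => ?_
        simp only [kernelFun, Pi.smul_apply]
        rw [← integral_smul]
        refine integral_congr_ae ?_
        filter_upwards [Lp.coeFn_smul a ψ] with η h4
        simp only [Pi.smul_apply] at h4
        simp only [h4, smul_eq_mul]
        ring))
    1 fun K ψ => by
      simp only [LinearMap.mk₂_apply, one_mul]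
      have h := (memLp_kernelFun K ψ).2
      rw [← eLpNorm_two_sq, ← mul_pow] at h
      have h2 : eLpNorm (kernelFun K ψ) 2 volume ≤ ‖K‖ₑ * ‖ψ‖ₑ :=
        (ENNReal.pow_le_pow_left_iff two_ne_zero).1 h
      rw [Lp.norm_toLp]
      refine (ENNReal.toReal_mono (by finiteness) h2).trans ?_
      simp

theorem coeFn_kernelOp (K : Lp ℂ 2 (volume : Measure (EucSp n × EucSp n))) (ψ : L2Euc n) :
    kernelOp n K ψ =ᵐ[volume] kernelFun K ψ :=
  (memLp_kernelFun K ψ).1.coeFn_toLp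

instance countable_onbIndex (n : ℕ) : Countable (onbIndex n) := by
  have : Fact ((2 : ENNReal) ≠ ⊤) := ⟨ENNReal.ofNat_ne_top⟩
  have ho := (onb n).orthonormal
  have hd : ∀ i j, i ≠ j → 1 ≤ dist (onb n i) (onb n j) := by
    intro i j hij
    have h1 : ‖onb n i - onb n j‖ ^ 2 = 2 := by
      rw [@norm_sub_sq ℂ, ho.inner_eq_zero hij, ho.norm_eq_one, ho.norm_eq_one]
      norm_num
    rw [dist_eq_norm]
    nlinarith [norm_nonneg (onb n i - onb n j)]
  refine Pairwise.countable_of_isOpen_disjoint (s := fun i => Metric.ball (onb n i) (1 / 2))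
    (fun i j hij => ?_) (fun i => Metric.isOpen_ball)
    (fun i => ⟨onb n i, Metric.mem_ball_self (by norm_num)⟩)
  refine Metric.ball_disjoint_ball ?_
  have := hd i j hij
  linarith

theorem tsum_enorm_inner_sq {ι H : Type*} [NormedAddCommGroup H] [InnerProductSpace ℂ H]
    (b : HilbertBasis ι ℂ H) (x : H) : ∑' i, ‖(inner ℂ x (b i) : ℂ)‖ₑ ^ 2 = ‖x‖ₑ ^ 2 := by
  have h := b.hasSum_inner_mul_inner x x
  have e : ∀ i, (inner ℂ x (b i) : ℂ) * inner ℂ (b i) x =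
      ((‖(inner ℂ x (b i) : ℂ)‖ ^ 2 : ℝ) : ℂ) := by
    intro i
    rw [← inner_conj_symm (b i) x, Complex.mul_conj, Complex.normSq_eq_norm_sq]
  simp_rw [e] at h
  rw [inner_self_eq_norm_sq_to_K] at h
  have h' : HasSum (fun i => ‖(inner ℂ x (b i) : ℂ)‖ ^ 2) (‖x‖ ^ 2) := by
    refine Complex.hasSum_ofReal.1 ?_
    rw [Complex.ofReal_pow]
    exact h
  have e2 : ∀ i, ‖(inner ℂ x (b i) : ℂ)‖ₑ ^ 2 = ENNReal.ofReal (‖(inner ℂ x (b i) : ℂ)‖ ^ 2) :=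
    fun i => by rw [ENNReal.ofReal_pow (norm_nonneg _), ofReal_norm]
  simp_rw [e2]
  rw [← ENNReal.ofReal_tsum_of_nonneg (fun i => by positivity) h'.summable, h'.tsum_eq,
    ENNReal.ofReal_pow (norm_nonneg _), ofReal_norm]

/-- The Hilbert–Schmidt norm of an operator with kernel `K` is the `L²` norm of `K`. -/
theorem hsNormSq_kernelOp (K : Lp ℂ 2 (volume : Measure (EucSp n × EucSp n))) :
    hsNormSq (kernelOp n K) = ‖K‖ₑ ^ 2 := by
  have h1 : ∀ i, ‖kernelOp n K (onb n i)‖ₑ ^ 2 = ∫⁻ ξ, ‖kernelFun K (onb n i) ξ‖ₑ ^ 2 := by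
    intro i
    rw [enorm_sq_eq_lintegral]
    refine lintegral_congr_ae ?_
    filter_upwards [coeFn_kernelOp K (onb n i)] with ξ h
    rw [h]
  simp only [hsNormSq]
  simp_rw [h1]
  rw [← lintegral_tsum fun i => (memLp_kernelFun K (onb n i)).1.1.enorm.pow_const 2,
    enorm_sq_eq_lintegral,
    lintegral_volume_prod ((Lp.stronglyMeasurable K).enorm.pow_const 2).aemeasurable]
  refine lintegral_congr_ae ?_
  filter_upwards [ae_memLp_section (Lp.memLp K)] with ξ h
  have hc : MemLp (fun η => (starRingEnd ℂ) (K (ξ, η))) 2 := h.star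
  have e : ∀ i, kernelFun K (onb n i) ξ = inner ℂ (hc.toLp _) (onb n i) := by
    intro i
    rw [L2.inner_def]
    refine integral_congr_ae ?_
    filter_upwards [hc.coeFn_toLp] with η hη
    rw [hη]
    simp [mul_comm]
  simp_rw [e]
  rw [tsum_enorm_inner_sq, enorm_sq_eq_lintegral]
  refine lintegral_congr_ae ?_
  filter_upwards [hc.coeFn_toLp] with η hη
  rw [hη]
  simp

theorem hasSum_norm_kernelOp_sq (K : Lp ℂ 2 (volume : Measure (EucSp n × EucSp n))) :
    HasSum (fun i => ‖kernelOp n K (onb n i)‖ ^ 2) (‖K‖ ^ 2) := by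
  have h := hsNormSq_kernelOp K
  have e : ∀ i, ‖kernelOp n K (onb n i)‖ₑ ^ 2 = ENNReal.ofReal (‖kernelOp n K (onb n i)‖ ^ 2) :=
    fun i => by rw [ENNReal.ofReal_pow (norm_nonneg _), ofReal_norm]
  simp only [hsNormSq] at h
  simp_rw [e] at h
  have hs : Summable fun i => ‖kernelOp n K (onb n i)‖ ^ 2 :=
    (ENNReal.summable_toReal (by rw [h]; finiteness)).congr fun i =>
      ENNReal.toReal_ofReal (by positivity)
  rw [← ENNReal.ofReal_tsum_of_nonneg (fun i => by positivity) hs, ← ofReal_norm,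
    ← ENNReal.ofReal_pow (norm_nonneg _),
    ENNReal.ofReal_eq_ofReal_iff (tsum_nonneg fun i => by positivity) (by positivity)] at h
  rw [← h]
  exact hs.hasSum

/-- The Hilbert–Schmidt inner product of operators with `L²` kernels, obtained from
`hsNormSq_kernelOp` by polarization. -/
theorem hsInner_kernelOp (A B : Lp ℂ 2 (volume : Measure (EucSp n × EucSp n))) :
    hsInner (kernelOp n A) (kernelOp n B) = inner ℂ B A := by
  refine HasSum.tsum_eq ?_
  rw [inner_eq_polarization B A]
  have key : ∀ i, inner ℂ (kernelOp n B (onb n i)) (kernelOp n A (onb n i)) =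
      (((‖kernelOp n (B + A) (onb n i)‖ ^ 2 - ‖kernelOp n (B - A) (onb n i)‖ ^ 2 : ℝ) : ℂ) +
      ((‖kernelOp n (B - Complex.I • A) (onb n i)‖ ^ 2 -
        ‖kernelOp n (B + Complex.I • A) (onb n i)‖ ^ 2 : ℝ) : ℂ) * Complex.I) / 4 := by
    intro i
    rw [inner_eq_polarization]
    simp
  simp_rw [key]
  refine HasSum.div_const ?_ _
  refine HasSum.add ?_ (HasSum.mul_right _ ?_)
  · exact Complex.hasSum_ofReal.2 ((hasSum_norm_kernelOp_sq _).sub (hasSum_norm_kernelOp_sq _))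
  · exact Complex.hasSum_ofReal.2 ((hasSum_norm_kernelOp_sq _).sub (hasSum_norm_kernelOp_sq _))

theorem memLp_tensor (χ ψ : L2Euc n) :
    MemLp (fun q : EucSp n × EucSp n => (starRingEnd ℂ) (χ q.1) * ψ q.2) 2 volume := by
  have hχ := Lp.stronglyMeasurable χ
  have hψ := Lp.stronglyMeasurable ψ
  have hm : StronglyMeasurable fun q : EucSp n × EucSp n => (starRingEnd ℂ) (χ q.1) * ψ q.2 :=
    (Complex.continuous_conj.comp_stronglyMeasurable (hχ.comp_measurable measurable_fst)).mul
      (hψ.comp_measurable measurable_snd)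
  refine (memLp_two_iff hm.aestronglyMeasurable).2 ?_
  simp only [enorm_mul, mul_pow, RCLike.enorm_conj]
  rw [Measure.volume_eq_prod, lintegral_prod_mul (f := fun x => ‖χ x‖ₑ ^ 2)
    (g := fun x => ‖ψ x‖ₑ ^ 2) (hχ.enorm.pow_const 2).aemeasurable
    (hψ.enorm.pow_const 2).aemeasurable, ← enorm_sq_eq_lintegral, ← enorm_sq_eq_lintegral]
  finiteness

theorem inner_kernelOp (K : Lp ℂ 2 (volume : Measure (EucSp n × EucSp n))) (χ ψ : L2Euc n) :
    inner ℂ χ (kernelOp n K ψ) =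
      ∫ q : EucSp n × EucSp n, (starRingEnd ℂ) (χ q.1) * ψ q.2 * K q := by
  have hi := integrable_mul_of_memLp_two (memLp_tensor χ ψ) (Lp.memLp K)
  rw [integral_volume_prod hi, L2.inner_def]
  refine integral_congr_ae ?_
  filter_upwards [coeFn_kernelOp K ψ] with ξ h
  rw [h, RCLike.inner_apply, kernelFun, mul_comm, ← integral_const_mul]
  congr 1
  funext η
  ring

/-! ### The Schrödinger representation and the Fourier transform of integrable functions -/

/-- Pettis' theorem for the separable Hilbert space `L²(ℝⁿ)`: weakly measurable maps are strongly
measurable. -/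
theorem stronglyMeasurable_of_inner {X : Type*} [MeasurableSpace X] {u : X → L2Euc n}
    (h : ∀ χ : L2Euc n, StronglyMeasurable fun x => (inner ℂ χ (u x) : ℂ)) :
    StronglyMeasurable u := by
  refine stronglyMeasurable_of_tendsto (u := (atTop : Filter (Finset (onbIndex n))))
    (f := fun s x => ∑ i ∈ s, (inner ℂ (onb n i) (u x) : ℂ) • onb n i) (fun s => ?_) ?_
  · exact Finset.stronglyMeasurable_fun_sum s fun i _ => (h (onb n i)).smul_const _
  · refine tendsto_pi_nhds.2 fun x => ?_
    have := (onb n).hasSum_repr (u x)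
    simp_rw [(onb n).repr_apply_apply] at this
    exact this

theorem norm_schrodingerFun (lam : ℝ) (p : Heis n) (ψ : EucSp n → ℂ) (ξ : EucSp n) :
    ‖schrodingerFun lam p ψ ξ‖ = ‖ψ (ξ + p.1.2)‖ := by
  rw [schrodingerFun, norm_mul, norm_mul, norm_cexp_eq_one (by simp),
    norm_cexp_eq_one (by simp [-Complex.ofReal_add, -Complex.ofReal_mul]), one_mul, one_mul]

theorem stronglyMeasurable_schrodingerFun (lam : ℝ) {ψ : EucSp n → ℂ} (hψ : StronglyMeasurable ψ) :
    StronglyMeasurable fun q : Heis n × EucSp n => schrodingerFun lam q.1 ψ q.2 := by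
  simp only [schrodingerFun]
  refine StronglyMeasurable.mul (Continuous.stronglyMeasurable (by fun_prop)) ?_
  exact hψ.comp_measurable (Continuous.measurable (by fun_prop))

theorem coeFn_schrodinger (lam : ℝ) (p : Heis n) (ψ : L2Euc n) :
    schrodinger lam p ψ =ᵐ[volume] schrodingerFun lam p ψ :=
  (memLp_schrodingerFun lam p ψ).coeFn_toLp

theorem eLpNorm_schrodingerFun (lam : ℝ) (p : Heis n) (ψ : L2Euc n) :
    eLpNorm (schrodingerFun lam p ψ) 2 volume = ‖ψ‖ₑ := by
  rw [Lp.enorm_def, ← eLpNorm_comp_measurePreserving (Lp.aestronglyMeasurable ψ)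
    (measurePreserving_add_right volume p.1.2)]
  exact eLpNorm_congr_norm_ae (Eventually.of_forall fun ξ => norm_schrodingerFun lam p ψ ξ)

theorem norm_schrodinger (lam : ℝ) (p : Heis n) (ψ : L2Euc n) :
    ‖schrodinger lam p ψ‖ = ‖ψ‖ := by
  rw [schrodinger, Lp.norm_toLp, eLpNorm_schrodingerFun, toReal_enorm]

theorem inner_schrodinger (lam : ℝ) (p : Heis n) (χ ψ : L2Euc n) :
    inner ℂ χ (schrodinger lam p ψ) =
      ∫ ξ, (starRingEnd ℂ) (χ ξ) * schrodingerFun lam p ψ ξ := by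
  rw [L2.inner_def]
  refine integral_congr_ae ?_
  filter_upwards [coeFn_schrodinger lam p ψ] with ξ h
  rw [h, RCLike.inner_apply, mul_comm]

/-- Strong measurability, without which the vector-valued integral in `groupFourierL1` would be zero
by convention. -/
theorem stronglyMeasurable_schrodinger (lam : ℝ) (ψ : L2Euc n) :
    StronglyMeasurable fun p : Heis n => schrodinger lam p ψ := by
  refine stronglyMeasurable_of_inner fun χ => ?_
  simp_rw [inner_schrodinger]
  refine StronglyMeasurable.integral_prod_right' (f := fun q : Heis n × EucSp n =>
    (starRingEnd ℂ) (χ q.2) * schrodingerFun lam q.1 ψ q.2) ?_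
  exact (Complex.continuous_conj.comp_stronglyMeasurable
    ((Lp.stronglyMeasurable χ).comp_measurable measurable_snd)).mul
    (stronglyMeasurable_schrodingerFun lam (Lp.stronglyMeasurable ψ))

theorem lintegral_enorm_mul_le {X : Type*} [MeasurableSpace X] {μ : Measure X} {f g : X → ℂ}
    (hf : AEStronglyMeasurable f μ) (hg : AEStronglyMeasurable g μ) :
    ∫⁻ x, ‖f x‖ₑ * ‖g x‖ₑ ∂μ ≤ eLpNorm f 2 μ * eLpNorm g 2 μ := by
  have h2 := ENNReal.lintegral_mul_le_Lp_mul_Lq μ Real.HolderConjugate.two_two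
    hf.enorm hg.enorm
  rw [eLpNorm_eq_lintegral_rpow_enorm_toReal two_ne_zero ENNReal.ofNat_ne_top,
    eLpNorm_eq_lintegral_rpow_enorm_toReal two_ne_zero ENNReal.ofNat_ne_top]
  exact h2

/-- The absolute convergence behind the use of Fubini's theorem in `groupFourierL1_eq_kernelOp`. -/
theorem integrable_matrixCoeff (lam : ℝ) {f : Heis n → ℂ} (hfm : StronglyMeasurable f)
    (hf : Integrable f) (χ ψ : L2Euc n) :
    Integrable fun q : Heis n × EucSp n =>
      f q.1 * ((starRingEnd ℂ) (χ q.2) * schrodingerFun lam q.1 ψ q.2) := by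
  have hs := stronglyMeasurable_schrodingerFun lam (Lp.stronglyMeasurable ψ)
  have hm : StronglyMeasurable fun q : Heis n × EucSp n =>
      f q.1 * ((starRingEnd ℂ) (χ q.2) * schrodingerFun lam q.1 ψ q.2) :=
    (hfm.comp_measurable measurable_fst).mul ((Complex.continuous_conj.comp_stronglyMeasurable
      ((Lp.stronglyMeasurable χ).comp_measurable measurable_snd)).mul hs)
  refine ⟨hm.aestronglyMeasurable, ?_⟩
  rw [HasFiniteIntegral, lintegral_volume_prod hm.enorm.aemeasurable]
  calc ∫⁻ p, ∫⁻ ξ, ‖f p * ((starRingEnd ℂ) (χ ξ) * schrodingerFun lam p ψ ξ)‖ₑ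
      ≤ ∫⁻ p, ‖f p‖ₑ * (‖χ‖ₑ * ‖ψ‖ₑ) := by
        refine lintegral_mono fun p => ?_
        simp only [enorm_mul, RCLike.enorm_conj]
        rw [lintegral_const_mul' _ _ (by finiteness)]
        gcongr
        refine (lintegral_enorm_mul_le (Lp.aestronglyMeasurable χ)
          (hs.comp_measurable measurable_prodMk_left).aestronglyMeasurable).trans_eq ?_
        exact congrArg₂ (· * ·) (Lp.enorm_def χ).symm (eLpNorm_schrodingerFun lam p ψ)
    _ < ⊤ := by
        rw [lintegral_mul_const' _ _ (by finiteness)]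
        exact ENNReal.mul_lt_top hf.2 (by finiteness)

theorem integrable_smul_schrodinger (lam : ℝ) {f : Heis n → ℂ} (hf : Integrable f) (ψ : L2Euc n) :
    Integrable fun p => f p • schrodinger lam p ψ := by
  refine (hf.norm.mul_const ‖ψ‖).mono
    (hf.1.smul (stronglyMeasurable_schrodinger lam ψ).aestronglyMeasurable) ?_
  refine Eventually.of_forall fun p => ?_
  rw [norm_smul, norm_schrodinger, norm_mul, norm_norm, norm_norm]

/-- The group Fourier transform of an integrable function is the operator whose kernel is the
kernel of the Weyl transform of `f^λ`. -/
theorem groupFourierL1_eq_kernelOp {lam : ℝ} {f : Heis n → ℂ} (hfm : StronglyMeasurable f)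
    (hf : Integrable f) {K : Lp ℂ 2 (volume : Measure (EucSp n × EucSp n))}
    (hK : K =ᵐ[volume] weylInt lam fun z => centralInt f (z, lam)) (ψ : L2Euc n) :
    groupFourierL1 f lam ψ = kernelOp n K ψ := by
  refine ext_inner_left ℂ fun χ => ?_
  have hΦ := integrable_matrixCoeff lam hfm hf χ ψ
  have hi : Integrable fun q : EucSp n × EucSp n => (starRingEnd ℂ) (χ q.1) * ψ q.2 *
      weylInt lam (fun z => centralInt f (z, lam)) q := by
    refine (integrable_mul_of_memLp_two (memLp_tensor χ ψ) (Lp.memLp K)).congr ?_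
    filter_upwards [hK] with q hq
    rw [hq]
  calc inner ℂ χ (groupFourierL1 f lam ψ)
      = ∫ p, inner ℂ χ (f p • schrodinger lam p ψ) := by
        rw [groupFourierL1, ← integral_inner (integrable_smul_schrodinger lam hf ψ)]
    _ = ∫ p, ∫ ξ, f p * ((starRingEnd ℂ) (χ ξ) * schrodingerFun lam p ψ ξ) := by
        congr 1
        funext p
        rw [inner_smul_right, inner_schrodinger, integral_const_mul]
    _ = ∫ ξ, ∫ p, f p * ((starRingEnd ℂ) (χ ξ) * schrodingerFun lam p ψ ξ) :=
        integral_integral_swap hΦ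
    _ = ∫ ξ, ∫ y, (starRingEnd ℂ) (χ ξ) * ψ (ξ + y) *
          weylInt lam (fun z => centralInt f (z, lam)) (ξ, ξ + y) := by
        refine integral_congr_ae ?_
        filter_upwards [Integrable.prod_left_ae hΦ] with ξ hξ
        rw [integral_volume_prod hξ]
        have hξ2 : Integrable fun z : EucSp n × EucSp n => ∫ t, f (z, t) *
            ((starRingEnd ℂ) (χ ξ) * schrodingerFun lam (z, t) ψ ξ) := hξ.integral_prod_left
        rw [Measure.volume_eq_prod, integral_prod_symm _ hξ2]
        congr 1
        funext y
        simp only [weylInt, centralInt, add_sub_cancel_left]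
        rw [← integral_const_mul]
        congr 1
        funext x
        rw [← integral_mul_const, ← integral_const_mul]
        congr 1
        funext t
        simp only [schrodingerFun]
        have e : Complex.exp (2 * Real.pi * lam *
            ((inner ℝ x ξ + 1 / 2 * inner ℝ x y : ℝ) : ℂ) * Complex.I) =
            Complex.exp (Real.pi * lam * ((inner ℝ x (ξ + (ξ + y)) : ℝ) : ℂ) * Complex.I) := by
          congr 1
          simp only [inner_add_right]
          push_cast
          ring
        rw [e]
        ring
    _ = ∫ ξ, ∫ η, (starRingEnd ℂ) (χ ξ) * ψ η *
          weylInt lam (fun z => centralInt f (z, lam)) (ξ, η) := by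
        congr 1
        funext ξ
        exact integral_add_left_eq_self (fun η => (starRingEnd ℂ) (χ ξ) * ψ η *
          weylInt lam (fun z => centralInt f (z, lam)) (ξ, η)) ξ
    _ = ∫ q : EucSp n × EucSp n, (starRingEnd ℂ) (χ q.1) * ψ q.2 *
          weylInt lam (fun z => centralInt f (z, lam)) q := (integral_volume_prod hi).symm
    _ = inner ℂ χ (kernelOp n K ψ) := by
        rw [inner_kernelOp]
        refine integral_congr_ae ?_
        filter_upwards [hK] with q hq
        rw [hq]

/-! ### The group Fourier transform on `L²` -/

theorem ae_ae_slice {p : (EucSp n × EucSp n) × ℝ → Prop} (h : ∀ᵐ q, p q) :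
    ∀ᵐ lam : ℝ, ∀ᵐ z : EucSp n × EucSp n, p (z, lam) := by
  have h1 := (Measure.measurePreserving_swap (μ := (volume : Measure ℝ))
    (ν := (volume : Measure (EucSp n × EucSp n)))).quasiMeasurePreserving.ae h
  exact Measure.ae_ae_of_ae_prod h1

theorem lintegral_slice_sq (F : L2Heis n) :
    ∫⁻ lam : ℝ, ∫⁻ z : EucSp n × EucSp n, ‖F (z, lam)‖ₑ ^ 2 = ‖F‖ₑ ^ 2 := by
  rw [enorm_sq_eq_lintegral]
  exact (lintegral_prod_symm _
    ((Lp.stronglyMeasurable F).enorm.pow_const 2).aemeasurable).symm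

theorem stronglyMeasurable_slice (F : L2Heis n) (lam : ℝ) :
    StronglyMeasurable fun z : EucSp n × EucSp n => F (z, lam) :=
  (Lp.stronglyMeasurable F).comp_measurable measurable_prodMk_right

theorem measurable_lintegral_slice (F : L2Heis n) :
    Measurable fun lam : ℝ => ∫⁻ z : EucSp n × EucSp n, ‖F (z, lam)‖ₑ ^ 2 :=
  Measurable.lintegral_prod_left' (f := fun q : (EucSp n × EucSp n) × ℝ => ‖F q‖ₑ ^ 2)
    ((Lp.stronglyMeasurable F).enorm.pow_const 2)

theorem ae_memLp_slice (F : L2Heis n) :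
    ∀ᵐ lam : ℝ, MemLp (fun z : EucSp n × EucSp n => F (z, lam)) 2 volume := by
  have h := ae_lt_top (measurable_lintegral_slice F) (by rw [lintegral_slice_sq]; finiteness)
  filter_upwards [h] with lam hl
  exact (memLp_two_iff (stronglyMeasurable_slice F lam).aestronglyMeasurable).2 hl

open Classical in
/-- The slice `F(·, λ)` of a function `F ∈ L²(ℂⁿ × ℝ)` as an element of `L²(ℂⁿ)`; it is zero for the
null set of `λ` for which the slice is not square integrable. -/
def slice (F : L2Heis n) (lam : ℝ) : Lp ℂ 2 (volume : Measure (EucSp n × EucSp n)) :=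
  if h : MemLp (fun z : EucSp n × EucSp n => F (z, lam)) 2 volume then h.toLp _ else 0

theorem coeFn_slice_of_memLp {F : L2Heis n} {lam : ℝ}
    (h : MemLp (fun z : EucSp n × EucSp n => F (z, lam)) 2 volume) :
    slice F lam =ᵐ[volume] fun z => F (z, lam) := by
  rw [slice, dif_pos h]
  exact h.coeFn_toLp

theorem coeFn_slice (F : L2Heis n) :
    ∀ᵐ lam : ℝ, slice F lam =ᵐ[volume] fun z => F (z, lam) := by
  filter_upwards [ae_memLp_slice F] with lam h
  exact coeFn_slice_of_memLp h

theorem slice_sub (F F' : L2Heis n) :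
    ∀ᵐ lam : ℝ, slice (F - F') lam = slice F lam - slice F' lam := by
  filter_upwards [coeFn_slice (F - F'), coeFn_slice F, coeFn_slice F',
    ae_ae_slice (Lp.coeFn_sub F F')] with lam h1 h2 h3 h4
  refine Lp.ext ?_
  filter_upwards [h1, h2, h3, h4, Lp.coeFn_sub (slice F lam) (slice F' lam)] with z a1 a2 a3 a4 a5
  rw [a1, a4, a5, Pi.sub_apply, Pi.sub_apply, a2, a3]

theorem enorm_slice_sq (F : L2Heis n) :
    ∀ᵐ lam : ℝ, ‖slice F lam‖ₑ ^ 2 = ∫⁻ z : EucSp n × EucSp n, ‖F (z, lam)‖ₑ ^ 2 := by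
  filter_upwards [coeFn_slice F] with lam h
  rw [enorm_sq_eq_lintegral]
  refine lintegral_congr_ae ?_
  filter_upwards [h] with z hz
  rw [hz]

theorem inner_slice (F F' : L2Heis n) :
    ∀ᵐ lam : ℝ, inner ℂ (slice F' lam) (slice F lam) =
      ∫ z : EucSp n × EucSp n, F (z, lam) * (starRingEnd ℂ) (F' (z, lam)) := by
  filter_upwards [coeFn_slice F, coeFn_slice F'] with lam h h'
  rw [L2.inner_def]
  refine integral_congr_ae ?_
  filter_upwards [h, h'] with z hz hz'
  rw [hz, hz', RCLike.inner_apply]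

theorem integrable_mul_conj (F F' : L2Heis n) :
    Integrable (fun q : (EucSp n × EucSp n) × ℝ => F q * (starRingEnd ℂ) (F' q)) volume :=
  integrable_mul_of_memLp_two (Lp.memLp F) (Lp.memLp F').star

theorem integrable_inner_slice (F F' : L2Heis n) :
    Integrable fun lam : ℝ => (inner ℂ (slice F' lam) (slice F lam) : ℂ) := by
  have h := (integrable_mul_conj F F').integral_prod_right
  refine h.congr ?_
  filter_upwards [inner_slice F F'] with lam hl
  rw [hl]

/-- The operator with kernel the kernel of the Weyl transform of the slice `F(·, λ)`. -/
def sliceOp (F : L2Heis n) (lam : ℝ) : L2Euc n →L[ℂ] L2Euc n :=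
  kernelOp n (weylFourier lam (slice F lam))

/-- The weight `|λ|ⁿ` of the Plancherel measure cancels the factor in `norm_weylFourier_sq`. -/
theorem hsNormSq_weylFourier {lam : ℝ} (hlam : lam ≠ 0)
    (f : Lp ℂ 2 (volume : Measure (EucSp n × EucSp n))) :
    hsNormSq (kernelOp n (weylFourier lam f)) * ENNReal.ofReal (|lam| ^ n) = ‖f‖ₑ ^ 2 := by
  rw [hsNormSq_kernelOp, ← ofReal_norm, ← ofReal_norm, ← ENNReal.ofReal_pow (norm_nonneg _),
    ← ENNReal.ofReal_pow (norm_nonneg _), ← ENNReal.ofReal_mul (by positivity),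
    norm_weylFourier_sq hlam]

theorem tendsto_integral_mul_of_eLpNorm {X : Type*} [MeasurableSpace X] {μ : Measure X}
    {τ K : X → ℂ} {k : ℕ → X → ℂ} (hτ : MemLp τ 2 μ) (hK : MemLp K 2 μ)
    (hk : ∀ N, AEStronglyMeasurable (k N) μ)
    (h : Tendsto (fun N => eLpNorm (fun x => K x - k N x) 2 μ) atTop (𝓝 0)) :
    Tendsto (fun N => ∫ x, τ x * k N x ∂μ) atTop (𝓝 (∫ x, τ x * K x ∂μ)) := by
  rw [tendsto_iff_edist_tendsto_0]
  have h1 : Tendsto (fun N => eLpNorm τ 2 μ * eLpNorm (fun x => K x - k N x) 2 μ) atTop (𝓝 0) := by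
    simpa using ENNReal.Tendsto.const_mul h (Or.inr hτ.2.ne)
  refine tendsto_of_tendsto_of_tendsto_of_le_of_le' tendsto_const_nhds h1
    (Eventually.of_forall fun _ => zero_le) ?_
  filter_upwards [h.eventually (gt_mem_nhds ENNReal.zero_lt_top)] with N hN
  have hd : MemLp (fun x => K x - k N x) 2 μ := ⟨hK.1.sub (hk N), hN⟩
  have hkN : MemLp (k N) 2 μ := by
    refine (hK.sub hd).ae_eq (Eventually.of_forall fun x => ?_)
    simp
  rw [edist_comm, edist_eq_enorm_sub, ← integral_sub (integrable_mul_of_memLp_two hτ hK)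
    (integrable_mul_of_memLp_two hτ hkN)]
  refine (enorm_integral_le_lintegral_enorm _).trans ?_
  simp_rw [← mul_sub, enorm_mul]
  exact lintegral_enorm_mul_le hτ.1 hd.1

/-- The matrix coefficients of `sliceOp` are limits of absolutely convergent integrals depending
measurably on `λ`. -/
theorem measurable_inner_sliceOp (F : L2Heis n) (χ ψ : L2Euc n) :
    Measurable fun lam => (inner ℂ χ (sliceOp F lam ψ) : ℂ) := by
  -- The set of `λ` at which `sliceOp F lam` is not zero by convention.
  let S : Set ℝ := {lam | lam ≠ 0 ∧ ∫⁻ z : EucSp n × EucSp n, ‖F (z, lam)‖ₑ ^ 2 < ⊤}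
  have hS : MeasurableSet S := (measurableSet_singleton (0 : ℝ)).compl.inter
    (measurableSet_lt (measurable_lintegral_slice F) measurable_const)
  let k : ℕ → ℝ → EucSp n × EucSp n → ℂ := fun N lam q =>
    ∫ x in Metric.closedBall (0 : EucSp n) (N : ℝ), F ((x, q.2 - q.1), lam) *
      Complex.exp (Real.pi * lam * ((inner ℝ x (q.1 + q.2) : ℝ) : ℂ) * Complex.I)
  have hk : ∀ N, StronglyMeasurable fun p : ℝ × (EucSp n × EucSp n) => k N p.1 p.2 := fun N => by
    refine StronglyMeasurable.integral_prod_right'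
      (f := fun p : (ℝ × (EucSp n × EucSp n)) × EucSp n => F ((p.2, p.1.2.2 - p.1.2.1), p.1.1) *
        Complex.exp (Real.pi * p.1.1 * ((inner ℝ p.2 (p.1.2.1 + p.1.2.2) : ℝ) : ℂ) * Complex.I)) ?_
    exact ((Lp.stronglyMeasurable F).comp_measurable (Continuous.measurable (by fun_prop))).mul
      (Continuous.stronglyMeasurable (by fun_prop))
  have hτ := memLp_tensor χ ψ
  have hτm : StronglyMeasurable fun q : EucSp n × EucSp n => (starRingEnd ℂ) (χ q.1) * ψ q.2 :=
    (Complex.continuous_conj.comp_stronglyMeasurable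
      ((Lp.stronglyMeasurable χ).comp_measurable measurable_fst)).mul
      ((Lp.stronglyMeasurable ψ).comp_measurable measurable_snd)
  have hm : ∀ N, Measurable (S.indicator fun lam => ∫ q : EucSp n × EucSp n,
      (starRingEnd ℂ) (χ q.1) * ψ q.2 * k N lam q) := fun N => by
    refine Measurable.indicator (StronglyMeasurable.measurable ?_) hS
    refine StronglyMeasurable.integral_prod_right'
      (f := fun p : ℝ × (EucSp n × EucSp n) =>
        (starRingEnd ℂ) (χ p.2.1) * ψ p.2.2 * k N p.1 p.2) ?_
    exact (hτm.comp_measurable measurable_snd).mul (hk N)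
  refine measurable_of_tendsto_metrizable hm (tendsto_pi_nhds.2 fun lam => ?_)
  by_cases hl : lam ∈ S
  · simp only [Set.indicator_of_mem hl]
    rw [sliceOp, inner_kernelOp]
    have hM : MemLp (fun z : EucSp n × EucSp n => F (z, lam)) 2 volume :=
      (memLp_two_iff (stronglyMeasurable_slice F lam).aestronglyMeasurable).2 hl.2
    have hW := isWeylKernel_congr (coeFn_slice_of_memLp hM)
      ((weylFourier_spec hl.1).2.2 (slice F lam))
    refine tendsto_integral_mul_of_eLpNorm hτ hW.memLp (fun N => ?_) hW.tendsto
    exact ((hk N).comp_measurable measurable_prodMk_left).aestronglyMeasurable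
  · simp only [Set.indicator_of_notMem hl]
    refine tendsto_const_nhds.congr fun _ => ?_
    by_cases h0 : lam = 0
    · simp [sliceOp, weylFourier, h0]
    · have : slice F lam = 0 := by
        rw [slice, dif_neg]
        exact fun hM => hl ⟨h0, (memLp_two_iff hM.1).1 hM⟩
      simp [sliceOp, this]

theorem integrable_indicator_closedBall (φ : L2Heis n) (R : ℝ) :
    Integrable (Set.indicator (Metric.closedBall (0 : Heis n) R) φ) := by
  rw [integrable_indicator_iff Metric.isClosed_closedBall.measurableSet]
  have : IsFiniteMeasure
      ((volume : Measure (Heis n)).restrict (Metric.closedBall (0 : Heis n) R)) :=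
    ⟨by
      rw [Measure.restrict_apply_univ]
      exact (isCompact_closedBall (0 : Heis n) R).measure_lt_top⟩
  exact ((Lp.memLp φ).restrict _).integrable (by norm_num)

theorem memLp_indicator_closedBall (φ : L2Heis n) (R : ℝ) :
    MemLp (Set.indicator (Metric.closedBall (0 : Heis n) R) φ) 2 volume :=
  (Lp.memLp φ).indicator Metric.isClosed_closedBall.measurableSet

theorem tendsto_toLp_indicator_closedBall (φ : L2Heis n) :
    Tendsto (fun N : ℕ => (memLp_indicator_closedBall φ N).toLp _) atTop (𝓝 φ) := by
  rw [tendsto_iff_edist_tendsto_0]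
  refine (tendsto_eLpNorm_indicator_sub (A := fun N : ℕ => Metric.closedBall (0 : Heis n) N)
    (fun N => Metric.isClosed_closedBall.measurableSet)
    (fun N M h => Metric.closedBall_subset_closedBall (Nat.cast_le.2 h))
    (fun x => ?_) (Lp.memLp φ)).congr fun N => ?_
  · obtain ⟨N, hN⟩ := exists_nat_ge ‖x‖
    exact ⟨N, mem_closedBall_zero_iff.2 hN⟩
  · rw [Lp.edist_def]
    refine eLpNorm_congr_ae ?_
    filter_upwards [(memLp_indicator_closedBall φ N).coeFn_toLp] with x hx
    simp [hx]

theorem indicator_closedBall_eq_zero (φ : L2Heis n) {R : ℝ} {q : Heis n} (h : R < ‖q‖) :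
    Set.indicator (Metric.closedBall (0 : Heis n) R) φ q = 0 :=
  Set.indicator_of_notMem (fun h' => not_le.2 h (mem_closedBall_zero_iff.1 h')) _

/-- The kernel of the Weyl transform of a slice of the central Fourier transform of a truncated
function is given by absolutely convergent integrals. -/
theorem weylFourier_slice_truncation (φ : L2Heis n) (N : ℕ) : ∀ᵐ lam : ℝ,
    weylFourier lam (slice (centralFourier n ((memLp_indicator_closedBall φ N).toLp _)) lam)
      =ᵐ[volume] weylInt lam fun z =>
        centralInt (Set.indicator (Metric.closedBall (0 : Heis n) N) φ) (z, lam) := by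
  have h1 := centralFourier_toLp (memLp_indicator_closedBall φ N) N fun q hq =>
    indicator_closedBall_eq_zero φ (hq.trans_le (norm_snd_le q))
  filter_upwards [ae_ae_slice h1, coeFn_slice (centralFourier n
    ((memLp_indicator_closedBall φ N).toLp _)), Measure.ae_ne volume (0 : ℝ)] with lam h2 h3 h0
  have h4 := h3.trans h2
  have hM := (Lp.memLp _).ae_eq h4
  have h5 := (weylFourier_spec h0).2.1 _ hM N fun q hq => by
    simp only [centralInt]
    refine integral_eq_zero_of_ae (Eventually.of_forall fun t => ?_)
    change _ * _ = (0 : ℂ)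
    rw [indicator_closedBall_eq_zero φ, zero_mul]
    exact hq.trans_le ((norm_fst_le q).trans (norm_fst_le (q, t)))
  have h6 : hM.toLp _ = slice (centralFourier n ((memLp_indicator_closedBall φ N).toLp _)) lam :=
    Lp.ext (hM.coeFn_toLp.trans h4.symm)
  rwa [h6] at h5

theorem groupFourierL1_truncation (φ : L2Heis n) (N : ℕ) : ∀ᵐ lam : ℝ, ∀ ψ : L2Euc n,
    groupFourierL1 (Set.indicator (Metric.closedBall 0 (N : ℝ)) φ) lam ψ =
      sliceOp (centralFourier n ((memLp_indicator_closedBall φ N).toLp _)) lam ψ := by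
  filter_upwards [weylFourier_slice_truncation φ N] with lam h ψ
  exact groupFourierL1_eq_kernelOp
    ((Lp.stronglyMeasurable φ).indicator Metric.isClosed_closedBall.measurableSet)
    (integrable_indicator_closedBall φ N) h ψ

/-- The integrand measuring the distance from `sliceOp` to the group Fourier transform of a
truncation of `φ` is the squared `L²` norm of a slice; in particular it is almost everywhere measurable. -/
theorem hsNormSq_sub_truncation (φ : L2Heis n) (N : ℕ) : ∀ᵐ lam : ℝ,
    hsNormSq (fun ψ => sliceOp (centralFourier n φ) lam ψ -
        groupFourierL1 (Set.indicator (Metric.closedBall 0 (N : ℝ)) φ) lam ψ) *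
        ENNReal.ofReal (|lam| ^ n) =
      ∫⁻ z : EucSp n × EucSp n, ‖(centralFourier n φ -
        centralFourier n ((memLp_indicator_closedBall φ N).toLp _) : L2Heis n) (z, lam)‖ₑ ^ 2 := by
  filter_upwards [groupFourierL1_truncation φ N, Measure.ae_ne volume (0 : ℝ),
    slice_sub (centralFourier n φ) (centralFourier n ((memLp_indicator_closedBall φ N).toLp _)),
    enorm_slice_sq (centralFourier n φ -
      centralFourier n ((memLp_indicator_closedBall φ N).toLp _))] with lam h1 h0 h2 h3
  rw [← h3, ← hsNormSq_weylFourier h0, h2]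
  simp_rw [h1]
  simp [sliceOp, hsNormSq]

/-- A version of the group Fourier transform of `φ` is given by the operators whose kernels are
those of the Weyl transforms of the slices of `centralFourier n φ`. -/
theorem isGroupFourier_sliceOp (φ : L2Heis n) :
    IsGroupFourier φ (sliceOp (centralFourier n φ)) where
  measurable ψ χ := measurable_inner_sliceOp _ χ ψ
  finite := by
    have h : ∀ᵐ lam : ℝ, hsNormSq (sliceOp (centralFourier n φ) lam) *
        ENNReal.ofReal (|lam| ^ n) =
          ∫⁻ z : EucSp n × EucSp n, ‖centralFourier n φ (z, lam)‖ₑ ^ 2 := by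
      filter_upwards [enorm_slice_sq (centralFourier n φ), Measure.ae_ne volume (0 : ℝ)]
        with lam h h0
      rw [← h]
      exact hsNormSq_weylFourier h0 _
    rw [lintegral_congr_ae h, lintegral_slice_sq]
    finiteness
  tendsto := by
    simp_rw [fun N : ℕ => lintegral_congr_ae (hsNormSq_sub_truncation φ N), lintegral_slice_sq]
    have h1 := ((centralFourier n).continuous.tendsto φ).comp (tendsto_toLp_indicator_closedBall φ)
    have h2 := tendsto_iff_edist_tendsto_0.1 h1
    have h3 := ((ENNReal.continuous_pow 2).tendsto 0).comp h2
    simp only [ne_eq, OfNat.ofNat_ne_zero, not_false_eq_true, zero_pow] at h3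
    refine h3.congr fun N => ?_
    simp only [Function.comp]
    rw [edist_comm, edist_eq_enorm_sub]

/-- A crude form of the triangle inequality for squared norms; the constant is irrelevant. -/
theorem enorm_sub_sq_le {H : Type*} [NormedAddCommGroup H] (a b g : H) :
    ‖a - b‖ₑ ^ 2 ≤ 4 * ‖a - g‖ₑ ^ 2 + 4 * ‖b - g‖ₑ ^ 2 := by
  have h : ‖a - b‖ₑ ≤ ‖a - g‖ₑ + ‖b - g‖ₑ := by
    have e : a - b = (a - g) - (b - g) := by abel
    rw [e]
    exact enorm_sub_le
  have h2 : ‖a - b‖ₑ ≤ 2 * max ‖a - g‖ₑ ‖b - g‖ₑ := by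
    rw [two_mul]
    exact h.trans (add_le_add (le_max_left _ _) (le_max_right _ _))
  calc _ ≤ (2 * max ‖a - g‖ₑ ‖b - g‖ₑ) ^ 2 := pow_le_pow_left' h2 2
    _ = 4 * (max ‖a - g‖ₑ ‖b - g‖ₑ) ^ 2 := by rw [mul_pow]; norm_num
    _ ≤ _ := by
      rcases max_choice ‖a - g‖ₑ ‖b - g‖ₑ with h | h <;> rw [h]
      · exact le_self_add
      · exact le_add_self

theorem measurable_hsNormSq_sub {Φ Φ' : ℝ → L2Euc n →L[ℂ] L2Euc n}
    (h : ∀ ψ χ : L2Euc n, Measurable fun lam => (inner ℂ χ (Φ lam ψ) : ℂ))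
    (h' : ∀ ψ χ : L2Euc n, Measurable fun lam => (inner ℂ χ (Φ' lam ψ) : ℂ)) :
    Measurable fun lam => hsNormSq fun ψ => Φ lam ψ - Φ' lam ψ := by
  refine Measurable.tsum fun i => ?_
  refine (StronglyMeasurable.enorm ?_).pow_const 2
  exact (stronglyMeasurable_of_inner fun χ => (h _ χ).stronglyMeasurable).sub
    (stronglyMeasurable_of_inner fun χ => (h' _ χ).stronglyMeasurable)

/-- The `L²` limit defining the group Fourier transform is unique. -/
theorem isGroupFourier_unique {φ : L2Heis n} {Φ : ℝ → L2Euc n →L[ℂ] L2Euc n}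
    (h : IsGroupFourier φ Φ) :
    ∀ᵐ lam : ℝ, ∀ i, Φ lam (onb n i) = sliceOp (centralFourier n φ) lam (onb n i) := by
  have h' := isGroupFourier_sliceOp φ
  have hz : ∫⁻ lam : ℝ, hsNormSq (fun ψ => Φ lam ψ - sliceOp (centralFourier n φ) lam ψ) *
      ENNReal.ofReal (|lam| ^ n) = 0 := by
    have ht := (ENNReal.Tendsto.const_mul h.tendsto (Or.inr (by norm_num : (4 : ENNReal) ≠ ⊤))).add
      (ENNReal.Tendsto.const_mul h'.tendsto (Or.inr (by norm_num : (4 : ENNReal) ≠ ⊤)))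
    rw [mul_zero, add_zero] at ht
    refine le_antisymm (ge_of_tendsto' ht fun N => ?_) zero_le
    have hm : AEMeasurable (fun lam : ℝ => hsNormSq (fun ψ => sliceOp (centralFourier n φ) lam ψ -
        groupFourierL1 (Set.indicator (Metric.closedBall 0 (N : ℝ)) φ) lam ψ) *
        ENNReal.ofReal (|lam| ^ n)) volume :=
      (measurable_lintegral_slice _).aemeasurable.congr
        (EventuallyEq.symm (hsNormSq_sub_truncation φ N))
    rw [← lintegral_const_mul' _ _ (by norm_num), ← lintegral_const_mul' _ _ (by norm_num),
      ← lintegral_add_right' _ (hm.const_mul 4)]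
    refine lintegral_mono fun lam => ?_
    simp only [hsNormSq]
    rw [← mul_assoc, ← mul_assoc, ← add_mul, ← ENNReal.tsum_mul_left, ← ENNReal.tsum_mul_left,
      ← ENNReal.tsum_add]
    gcongr
    exact enorm_sub_sq_le _ _ _
  have hw : Measurable fun lam : ℝ => ENNReal.ofReal (|lam| ^ n) := by fun_prop
  have hm : Measurable fun lam : ℝ =>
      hsNormSq (fun ψ => Φ lam ψ - sliceOp (centralFourier n φ) lam ψ) *
        ENNReal.ofReal (|lam| ^ n) :=
    (measurable_hsNormSq_sub h.measurable h'.measurable).mul hw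
  rw [lintegral_eq_zero_iff hm] at hz
  filter_upwards [hz, Measure.ae_ne volume (0 : ℝ)] with lam hl h0 i
  simp only [Pi.zero_apply, mul_eq_zero, ENNReal.ofReal_eq_zero, not_le.2 (show 0 < |lam| ^ n by
    positivity), or_false, hsNormSq, ENNReal.tsum_eq_zero] at hl
  have := hl i
  rw [pow_eq_zero_iff two_ne_zero, enorm_eq_zero] at this
  exact sub_eq_zero.1 this

theorem groupFourier_ae_eq (φ : L2Heis n) :
    ∀ᵐ lam : ℝ, ∀ i, groupFourier φ lam (onb n i) =
      sliceOp (centralFourier n φ) lam (onb n i) := by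
  have hex : ∃ Φ, IsGroupFourier φ Φ := ⟨_, isGroupFourier_sliceOp φ⟩
  have h := isGroupFourier_unique hex.choose_spec
  rw [groupFourier, dif_pos hex]
  exact h

/-- The Hilbert–Schmidt inner products of group Fourier transforms in terms of kernels. -/
theorem hsInner_groupFourier (φ ψ : L2Heis n) : ∀ᵐ lam : ℝ,
    hsInner (groupFourier φ lam) (groupFourier ψ lam) =
      inner ℂ (weylFourier lam (slice (centralFourier n ψ) lam))
        (weylFourier lam (slice (centralFourier n φ) lam)) := by
  filter_upwards [groupFourier_ae_eq φ, groupFourier_ae_eq ψ] with lam h1 h2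
  rw [← hsInner_kernelOp]
  simp only [hsInner, h1, h2, sliceOp]

/-- The fibrewise form of Plancherel's theorem for the group Fourier transform. -/
theorem hsInner_groupFourier_mul (φ ψ : L2Heis n) : ∀ᵐ lam : ℝ,
    hsInner (groupFourier φ lam) (groupFourier ψ lam) * ((|lam| ^ n : ℝ) : ℂ) =
      inner ℂ (slice (centralFourier n ψ) lam) (slice (centralFourier n φ) lam) := by
  filter_upwards [hsInner_groupFourier φ ψ, Measure.ae_ne volume (0 : ℝ)] with lam h h0
  rw [h, inner_weylFourier h0]

/-! ### Left translations -/

theorem memLp_twist {X : Type*} [MeasurableSpace X] {μ : Measure X} {u : X → ℂ}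
    (hu : AEStronglyMeasurable u μ) (hu1 : ∀ x, ‖u x‖ = 1) {τ : X → X}
    (hτ : MeasurePreserving τ μ μ) (f : Lp ℂ 2 μ) : MemLp (fun x => u x * f (τ x)) 2 μ :=
  ((Lp.memLp f).comp_measurePreserving hτ).of_le
    (hu.mul ((Lp.memLp f).comp_measurePreserving hτ).1)
    (Eventually.of_forall fun x => by simp [hu1])

/-- The isometry `f ↦ u · (f ∘ τ)` of `L²`, for a unimodular function `u` and a measure preserving
map `τ`. -/
def twist {X : Type*} [MeasurableSpace X] {μ : Measure X} {u : X → ℂ}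
    (hu : AEStronglyMeasurable u μ) (hu1 : ∀ x, ‖u x‖ = 1) {τ : X → X}
    (hτ : MeasurePreserving τ μ μ) : Lp ℂ 2 μ →ₗᵢ[ℂ] Lp ℂ 2 μ :=
  { toFun := fun f => (memLp_twist hu hu1 hτ f).toLp _
    map_add' := fun f g => by
      rw [← MemLp.toLp_add, MemLp.toLp_eq_toLp_iff]
      filter_upwards [hτ.quasiMeasurePreserving.ae (Lp.coeFn_add f g)] with x hx
      simp only [hx, Pi.add_apply, mul_add]
    map_smul' := fun a f => by
      rw [RingHom.id_apply, ← MemLp.toLp_const_smul, MemLp.toLp_eq_toLp_iff]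
      filter_upwards [hτ.quasiMeasurePreserving.ae (Lp.coeFn_smul a f)] with x hx
      simp only [hx, Pi.smul_apply, smul_eq_mul]
      ring
    norm_map' := fun f => by
      change ‖(memLp_twist hu hu1 hτ f).toLp _‖ = ‖f‖
      rw [Lp.norm_toLp, Lp.norm_def,
        ← eLpNorm_comp_measurePreserving (Lp.aestronglyMeasurable f) hτ]
      congr 1
      exact eLpNorm_congr_norm_ae (Eventually.of_forall fun x => by simp [hu1]) }

theorem coeFn_twist {X : Type*} [MeasurableSpace X] {μ : Measure X} {u : X → ℂ}
    (hu : AEStronglyMeasurable u μ) (hu1 : ∀ x, ‖u x‖ = 1) {τ : X → X}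
    (hτ : MeasurePreserving τ μ μ) (f : Lp ℂ 2 μ) :
    twist hu hu1 hτ f =ᵐ[μ] fun x => u x * f (τ x) :=
  (memLp_twist hu hu1 hτ f).coeFn_toLp

theorem leftTrans_ae_eq (a : Heis n) (f : L2Heis n) :
    leftTrans a f =ᵐ[volume] fun q => f (heisMul (heisInv a) q) :=
  Lp.coeFn_compMeasurePreserving f (measurePreserving_heisMul (heisInv a))

theorem inner_leftTrans (a : Heis n) (f g : L2Heis n) :
    inner ℂ (leftTrans a f) (leftTrans a g) = inner ℂ f g :=
  (Lp.compMeasurePreservingₗᵢ ℂ (heisMul (heisInv a))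
    (measurePreserving_heisMul (heisInv a))).inner_map_map f g

theorem continuous_leftTrans (a : Heis n) : Continuous (leftTrans (n := n) a) :=
  (Lp.compMeasurePreservingₗᵢ ℂ (heisMul (heisInv a))
    (measurePreserving_heisMul (heisInv a)) : L2Heis n →ₗᵢ[ℂ] L2Heis n).continuous

theorem heisMul_heisInv_heisMul (a q : Heis n) : heisMul a (heisMul (heisInv a) q) = q := by
  obtain ⟨⟨a1, a2⟩, a3⟩ := a
  obtain ⟨⟨x, y⟩, t⟩ := q
  simp only [heisMul, heisInv, Prod.neg_mk, Prod.mk_add_mk, add_neg_cancel_left, Prod.mk.injEq,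
    true_and, inner_add_right, inner_neg_left, inner_neg_right]
  rw [real_inner_comm a1 a2]
  ring

theorem heisMul_assoc (a b c : Heis n) : heisMul (heisMul a b) c = heisMul a (heisMul b c) := by
  simp only [heisMul, Prod.fst_add, Prod.snd_add, inner_add_left, inner_add_right, add_assoc,
    Prod.mk.injEq, true_and]
  ring

/-- The phase `e^{2πiλ(c + ½(b·x - a·y))}` by which left translation by `(a, b, c)` acts on the
central Fourier transform. -/
def centralPhase (a : Heis n) (q : (EucSp n × EucSp n) × ℝ) : ℂ :=
  Complex.exp (2 * Real.pi * q.2 *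
    ((a.2 + (1 / 2) * (inner ℝ a.1.2 q.1.1 - inner ℝ a.1.1 q.1.2) : ℝ) : ℂ) * Complex.I)

theorem continuous_centralPhase (a : Heis n) : Continuous (centralPhase a) := by
  unfold centralPhase
  fun_prop

theorem norm_centralPhase (a : Heis n) (q : (EucSp n × EucSp n) × ℝ) :
    ‖centralPhase a q‖ = 1 :=
  norm_cexp_eq_one (by simp [-Complex.ofReal_add, -Complex.ofReal_mul])

theorem measurePreserving_add_left_prod (v : EucSp n × EucSp n) :
    MeasurePreserving (fun z : EucSp n × EucSp n => v + z) volume volume :=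
  (measurePreserving_add_left (volume : Measure (EucSp n)) v.1).prod
    (measurePreserving_add_left (volume : Measure (EucSp n)) v.2)

theorem measurePreserving_centralShift (a : Heis n) :
    MeasurePreserving (fun q : (EucSp n × EucSp n) × ℝ => (-a.1 + q.1, q.2)) volume volume :=
  (measurePreserving_add_left_prod (-a.1)).prod (MeasurePreserving.id (volume : Measure ℝ))

theorem centralInt_heisMul (a : Heis n) (g : Heis n → ℂ) (q : (EucSp n × EucSp n) × ℝ) :
    centralInt (fun p => g (heisMul (heisInv a) p)) q =
      centralPhase a q * centralInt g (-a.1 + q.1, q.2) := by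
  simp only [centralInt]
  rw [← integral_add_right_eq_self _
    (a.2 + (1 / 2) * (inner ℝ a.1.2 q.1.1 - inner ℝ a.1.1 q.1.2)), ← integral_const_mul]
  congr 1
  funext t
  have e : heisMul (heisInv a) (q.1, t + (a.2 + (1 / 2) *
      (inner ℝ a.1.2 q.1.1 - inner ℝ a.1.1 q.1.2))) = (-a.1 + q.1, t) := by
    simp only [heisMul, heisInv, Prod.fst_neg, Prod.snd_neg, inner_neg_left, Prod.mk.injEq,
      true_and]
    ring
  rw [e, centralPhase, mul_left_comm, ← Complex.exp_add]
  congr 2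
  push_cast
  ring

/-- Left translation turns into a translation in `z` and a multiplication by a phase: the identity
holds for the integrals of truncated functions and extends by continuity. -/
theorem centralFourier_leftTrans (a : Heis n) (f : L2Heis n) :
    centralFourier n (leftTrans a f) =
      twist (continuous_centralPhase a).aestronglyMeasurable (norm_centralPhase a)
        (measurePreserving_centralShift a) (centralFourier n f) := by
  have h1 := ((centralFourier n).continuous.comp (continuous_leftTrans a)).tendsto f |>.comp
    (tendsto_toLp_indicator_closedBall f)
  have h2 := ((twist (continuous_centralPhase a).aestronglyMeasurable (norm_centralPhase a)
    (measurePreserving_centralShift a)).continuous.comp (centralFourier n).continuous).tendsto f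
    |>.comp (tendsto_toLp_indicator_closedBall f)
  refine tendsto_nhds_unique h1 (h2.congr fun N => ?_)
  simp only [Function.comp]
  have hf := memLp_indicator_closedBall f N
  have hT := centralFourier_toLp hf N fun q hq =>
    indicator_closedBall_eq_zero f (hq.trans_le (norm_snd_le q))
  have hg : MemLp (fun p => Set.indicator (Metric.closedBall (0 : Heis n) N) f
      (heisMul (heisInv a) p)) 2 volume :=
    hf.comp_measurePreserving (measurePreserving_heisMul (heisInv a))
  have hc : Continuous (heisMul a) := by
    unfold heisMul
    fun_prop
  -- the translate of a closed ball is bounded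
  obtain ⟨M, hM⟩ := ((isCompact_closedBall (0 : Heis n) N).image hc).isBounded.subset_closedBall 0
  obtain ⟨M', hM'⟩ := exists_nat_ge M
  have hT2 := centralFourier_toLp hg M' fun q hq => by
    refine Set.indicator_of_notMem (fun h => ?_) _
    have h3 := hM (Set.mem_image_of_mem _ h)
    rw [heisMul_heisInv_heisMul, mem_closedBall_zero_iff] at h3
    exact not_lt.2 ((norm_snd_le q).trans (h3.trans hM')) hq
  have e : leftTrans a (hf.toLp _) = hg.toLp _ := by
    refine Lp.ext ((leftTrans_ae_eq a _).trans (EventuallyEq.trans ?_ hg.coeFn_toLp.symm))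
    exact (measurePreserving_heisMul (heisInv a)).quasiMeasurePreserving.ae_eq_comp hf.coeFn_toLp
  rw [e]
  refine Lp.ext ((coeFn_twist _ _ _ _).trans (EventuallyEq.trans ?_ hT2.symm))
  filter_upwards [(measurePreserving_centralShift a).quasiMeasurePreserving.ae hT] with q hq
  rw [hq, centralInt_heisMul]

/-- The phase `e^{2πiλ(c + a·ξ + ½ a·b)}` of the Schrödinger representation of `(a, b, c)`. -/
def weylPhase (lam : ℝ) (a : Heis n) (q : EucSp n × EucSp n) : ℂ :=
  Complex.exp (2 * Real.pi * lam *
    ((a.2 + inner ℝ a.1.1 q.1 + (1 / 2) * inner ℝ a.1.1 a.1.2 : ℝ) : ℂ) * Complex.I)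

theorem continuous_weylPhase (lam : ℝ) (a : Heis n) : Continuous (weylPhase lam a) := by
  unfold weylPhase
  fun_prop

theorem norm_weylPhase (lam : ℝ) (a : Heis n) (q : EucSp n × EucSp n) :
    ‖weylPhase lam a q‖ = 1 :=
  norm_cexp_eq_one (by simp [-Complex.ofReal_add, -Complex.ofReal_mul])

theorem measurePreserving_weylShift (b : EucSp n) :
    MeasurePreserving (fun q : EucSp n × EucSp n => (q.1 + b, q.2)) volume volume :=
  (measurePreserving_add_right (volume : Measure (EucSp n)) b).prod
    (MeasurePreserving.id (volume : Measure (EucSp n)))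

theorem continuous_centralPhase_left (a : Heis n) (lam : ℝ) :
    Continuous fun z : EucSp n × EucSp n => centralPhase a (z, lam) :=
  (continuous_centralPhase a).comp (by fun_prop)

theorem weylInt_centralPhase (a : Heis n) (lam : ℝ) (g : EucSp n × EucSp n → ℂ)
    (q : EucSp n × EucSp n) :
    weylInt lam (fun z => centralPhase a (z, lam) * g (-a.1 + z)) q =
      weylPhase lam a q * weylInt lam g (q.1 + a.1.2, q.2) := by
  simp only [weylInt]
  rw [← integral_add_right_eq_self _ a.1.1, ← integral_const_mul]
  congr 1
  funext x
  have e : -a.1 + (x + a.1.1, q.2 - q.1) = (x, q.2 - (q.1 + a.1.2)) := by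
    ext1
    · simp
    · simp only [Prod.snd_add, Prod.snd_neg]
      abel
  rw [e, mul_right_comm, mul_left_comm, mul_comm (g _), centralPhase, weylPhase,
    ← Complex.exp_add, ← Complex.exp_add]
  congr 2
  simp only [inner_add_left, inner_add_right, inner_sub_right]
  rw [real_inner_comm a.1.1 a.1.2, real_inner_comm x a.1.2]
  push_cast
  ring

/-- The intertwining relation `(L_a φ)^(λ) = π_λ(a) φ̂(λ)` on the level of kernels. -/
theorem weylFourier_twist {lam : ℝ} (hlam : lam ≠ 0) (a : Heis n)
    (g : Lp ℂ 2 (volume : Measure (EucSp n × EucSp n))) :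
    weylFourier lam (twist (continuous_centralPhase_left a lam).aestronglyMeasurable
        (fun z => norm_centralPhase a (z, lam)) (measurePreserving_add_left_prod (-a.1)) g) =
      twist (continuous_weylPhase lam a).aestronglyMeasurable (norm_weylPhase lam a)
        (measurePreserving_weylShift a.1.2) (weylFourier lam g) := by
  have hA : ∀ N : ℕ, MeasurableSet {q : EucSp n × EucSp n | ‖q.1‖ ≤ N} := fun N =>
    measurableSet_le (by fun_prop) (by fun_prop)
  have hf : ∀ N : ℕ, MemLp ({q : EucSp n × EucSp n | ‖q.1‖ ≤ N}.indicator g) 2 volume :=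
    fun N => (Lp.memLp g).indicator (hA N)
  have hlim : Tendsto (fun N => (hf N).toLp _) atTop (𝓝 g) := by
    rw [tendsto_iff_edist_tendsto_0]
    refine (tendsto_eLpNorm_indicator_sub hA
      (fun N M h q hq => le_trans (α := ℝ) hq (Nat.cast_le.2 h))
      (fun q => exists_nat_ge ‖q.1‖) (Lp.memLp g)).congr fun N => ?_
    rw [Lp.edist_def]
    refine eLpNorm_congr_ae ?_
    filter_upwards [(hf N).coeFn_toLp] with x hx
    simp [hx]
  have h1 := ((weylFourier lam).continuous.comp
    (twist (continuous_centralPhase_left a lam).aestronglyMeasurable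
        (fun z => norm_centralPhase a (z, lam))
        (measurePreserving_add_left_prod (-a.1))).continuous).tendsto g |>.comp hlim
  have h2 := ((twist (continuous_weylPhase lam a).aestronglyMeasurable (norm_weylPhase lam a)
        (measurePreserving_weylShift a.1.2)).continuous.comp
        (weylFourier lam).continuous).tendsto g |>.comp hlim
  refine tendsto_nhds_unique h1 (h2.congr fun N => ?_)
  simp only [Function.comp]
  have hT := (weylFourier_spec hlam).2.1 _ (hf N) N fun q hq =>
    Set.indicator_of_notMem (s := {q : EucSp n × EucSp n | ‖q.1‖ ≤ N})
      (fun h : ‖q.1‖ ≤ N => not_lt.2 h hq) _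
  have e := coeFn_twist (continuous_centralPhase_left a lam).aestronglyMeasurable
        (fun z => norm_centralPhase a (z, lam)) (measurePreserving_add_left_prod (-a.1))
        ((hf N).toLp _)
  have e2 : (fun z => centralPhase a (z, lam) * ((hf N).toLp _ : _ → ℂ) (-a.1 + z)) =ᵐ[volume]
      fun z => centralPhase a (z, lam) *
        {q : EucSp n × EucSp n | ‖q.1‖ ≤ N}.indicator g (-a.1 + z) := by
    filter_upwards [(measurePreserving_add_left_prod (-a.1)).quasiMeasurePreserving.ae
      (hf N).coeFn_toLp] with z hz
    rw [hz]
  have hM := (Lp.memLp _).ae_eq (e.trans e2)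
  obtain ⟨M, hM1⟩ := exists_nat_ge (N + ‖a.1.1‖)
  have hT2 := (weylFourier_spec hlam).2.1 _ hM M fun q hq => by
    rw [Set.indicator_of_notMem, mul_zero]
    intro h
    have h3 : ‖-a.1.1 + q.1‖ ≤ N := h
    have h4 : ‖q.1‖ ≤ ‖-a.1.1 + q.1‖ + ‖a.1.1‖ := by
      have := norm_add_le (-a.1.1 + q.1) a.1.1
      rwa [add_comm (-a.1.1), neg_add_cancel_right, add_comm q.1] at this
    linarith
  have h6 : hM.toLp _ = twist (continuous_centralPhase_left a lam).aestronglyMeasurable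
        (fun z => norm_centralPhase a (z, lam)) (measurePreserving_add_left_prod (-a.1))
        ((hf N).toLp _) :=
    Lp.ext (hM.coeFn_toLp.trans (e.trans e2).symm)
  rw [← h6]
  refine Lp.ext ((coeFn_twist _ _ _ _).trans (EventuallyEq.trans ?_ hT2.symm))
  filter_upwards [(measurePreserving_weylShift a.1.2).quasiMeasurePreserving.ae hT] with q hq
  rw [hq, weylInt_centralPhase]

/-- Left translation by `(a, b, c)` acts on central Fourier transforms fibre by fibre. -/
theorem slice_leftTrans (a : Heis n) (φ : L2Heis n) : ∀ᵐ lam : ℝ,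
    slice (centralFourier n (leftTrans a φ)) lam =
      twist (continuous_centralPhase_left a lam).aestronglyMeasurable
        (fun z => norm_centralPhase a (z, lam)) (measurePreserving_add_left_prod (-a.1))
        (slice (centralFourier n φ) lam) := by
  have h := coeFn_twist (continuous_centralPhase a).aestronglyMeasurable (norm_centralPhase a)
        (measurePreserving_centralShift a) (centralFourier n φ)
  rw [← centralFourier_leftTrans] at h
  filter_upwards [coeFn_slice (centralFourier n (leftTrans a φ)), coeFn_slice (centralFourier n φ),
    ae_ae_slice h] with lam h1 h2 h3
  refine Lp.ext (h1.trans (EventuallyEq.trans ?_ (coeFn_twist _ _ _ _).symm))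
  filter_upwards [h3, (measurePreserving_add_left_prod (-a.1)).quasiMeasurePreserving.ae h2]
    with z a1 a2
  rw [a1, a2]

/-! ### The bracket in terms of the kernels of the Weyl transform -/

theorem ae_forall_add_int {p : ℝ → Prop} (h : ∀ᵐ lam, p lam) :
    ∀ᵐ lam : ℝ, ∀ r : ℤ, p (lam + r) :=
  ae_all_iff.2 fun r =>
    (measurePreserving_add_right (volume : Measure ℝ) (r : ℝ)).quasiMeasurePreserving.ae h

theorem inner_intVec (k s : Fin n → ℤ) :
    inner ℝ (intVec k) (intVec s) = ((∑ i, k i * s i : ℤ) : ℝ) := by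
  simp [intVec, PiLp.inner_apply, mul_comm]

theorem measurableSet_unitCube (n : ℕ) : MeasurableSet (unitCube n) := by
  have : unitCube n = ⋂ i, (fun ξ : EucSp n => ξ i) ⁻¹' Set.Ico (0 : ℝ) 1 := by
    ext ξ
    simp [unitCube]
  rw [this]
  refine MeasurableSet.iInter fun i => ?_
  have hc : Continuous fun ξ : EucSp n => ξ i := by fun_prop
  exact hc.measurable measurableSet_Ico

/-- The integer translates of the unit cube tile `ℝⁿ`. -/
theorem hasSum_integral_unitCube {h : EucSp n → ℂ} (hh : Integrable h) :
    HasSum (fun s : Fin n → ℤ => ∫ ξ in unitCube n, h (ξ + intVec s)) (∫ ξ, h ξ) := by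
  let A : (Fin n → ℤ) → Set (EucSp n) := fun s => (fun ξ => ξ - intVec s) ⁻¹' unitCube n
  have hmem : ∀ s ξ, ξ ∈ A s ↔ ∀ i, s i = ⌊ξ i⌋ := by
    intro s ξ
    simp only [A, unitCube, Set.mem_preimage, Set.mem_ofPred_eq, Set.mem_Ico,
      PiLp.sub_apply, intVec]
    refine forall_congr' fun i => ?_
    rw [eq_comm, Int.floor_eq_iff]
    constructor <;> rintro ⟨h1, h2⟩ <;> constructor <;> linarith
  have hA : ∀ s, MeasurableSet (A s) := fun s =>
    (measurable_id.sub_const (intVec s)) (measurableSet_unitCube n)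
  have hd : Pairwise (Function.onFun Disjoint A) := fun s s' hs => by
    refine Set.disjoint_left.2 fun ξ h1 h2 => hs (funext fun i => ?_)
    rw [(hmem s ξ).1 h1 i, (hmem s' ξ).1 h2 i]
  have hU : ⋃ s, A s = Set.univ :=
    Set.eq_univ_of_forall fun ξ => Set.mem_iUnion.2 ⟨fun i => ⌊ξ i⌋, (hmem _ ξ).2 fun i => rfl⟩
  have key := hasSum_integral_iUnion (f := h) (μ := volume) hA hd
    (by rw [hU]; exact hh.integrableOn)
  rw [hU, setIntegral_univ] at key
  refine key.congr_fun fun s => ?_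
  have hp := measurePreserving_add_right (volume : Measure (EucSp n)) (intVec s)
  have e := hp.setIntegral_preimage_emb (Homeomorph.addRight (intVec s)).measurableEmbedding h (A s)
  rw [← e]
  have e2 : (fun ξ => ξ + intVec s) ⁻¹' A s = unitCube n := by
    ext ξ
    simp [A]
  rw [e2]

/-- The function `ξ ↦ ∫ K(ξ,η) conj K(ξ+l,η) e^{-2πiλk·(l+2ξ)} dη`. Its values at `ξ + s`, for
`ξ ∈ [0,1)ⁿ` and `s ∈ ℤⁿ`, are the inner integrals in the definition of `G`. -/
def crossCorr (k l : Fin n → ℤ) (lam : ℝ) (K : EucSp n → EucSp n → ℂ) (ξ : EucSp n) : ℂ :=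
  ∫ η, K ξ η * (starRingEnd ℂ) (K (ξ + intVec l) η) *
    Complex.exp (-(2 * Real.pi * lam *
      ((inner ℝ (intVec k) (intVec l + (2 : ℝ) • ξ) : ℝ) : ℂ) * Complex.I))

theorem conj_weylPhase_latPt (lam : ℝ) (k l : Fin n → ℤ) (q : EucSp n × EucSp n) :
    (starRingEnd ℂ) (weylPhase lam (latPt k l 0) q) =
      Complex.exp (-(2 * Real.pi * lam *
        ((inner ℝ (intVec k) (intVec l + (2 : ℝ) • q.1) : ℝ) : ℂ) * Complex.I)) := by
  rw [weylPhase, ← Complex.exp_conj]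
  congr 1
  simp only [map_mul, Complex.conj_I, Complex.conj_ofReal, latPt, inner_add_right, inner_smul_left,
    inner_smul_right, map_ofNat, Int.cast_zero]
  push_cast
  ring

/-- The integral of `crossCorr` over `ℝⁿ` is the Hilbert–Schmidt inner product of `φ̂(λ)` and
`(L_{(2k,l,0)} φ)^(λ)`. -/
theorem crossCorr_integrable_integral (k l : Fin n → ℤ) (φ : L2Heis n) : ∀ᵐ lam : ℝ,
    Integrable (crossCorr k l lam (weylKernel lam (fourierT φ lam))) ∧
    ∫ ξ, crossCorr k l lam (weylKernel lam (fourierT φ lam)) ξ =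
      hsInner (groupFourier φ lam) (groupFourier (leftTrans (latPt k l 0) φ) lam) := by
  filter_upwards [hsInner_groupFourier φ (leftTrans (latPt k l 0) φ),
    slice_leftTrans (latPt k l 0) φ, fourierT_ae_eq φ, coeFn_slice (centralFourier n φ),
    Measure.ae_ne volume (0 : ℝ)] with lam h1 h2 h3 h4 h0
  rw [h1, h2, weylFourier_twist h0]
  have hK := weylKernel_ae_eq h0 (h3.trans h4.symm)
  set K := weylKernel lam (fourierT φ lam)
  set K' := weylFourier lam (slice (centralFourier n φ) lam)
  set T := twist (continuous_weylPhase lam (latPt k l 0)).aestronglyMeasurable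
    (norm_weylPhase lam (latPt k l 0)) (measurePreserving_weylShift (latPt k l 0).1.2) K' with hTd
  have hT := coeFn_twist (continuous_weylPhase lam (latPt k l 0)).aestronglyMeasurable
    (norm_weylPhase lam (latPt k l 0)) (measurePreserving_weylShift (latPt k l 0).1.2) K'
  rw [← hTd] at hT
  have hae : (fun q => K' q * (starRingEnd ℂ) (T q)) =ᵐ[volume] fun q : EucSp n × EucSp n =>
      K q.1 q.2 * (starRingEnd ℂ) (K (q.1 + intVec l) q.2) *
        Complex.exp (-(2 * Real.pi * lam *
          ((inner ℝ (intVec k) (intVec l + (2 : ℝ) • q.1) : ℝ) : ℂ) * Complex.I)) := by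
    filter_upwards [hK, hT, (measurePreserving_weylShift
      (intVec l : EucSp n)).quasiMeasurePreserving.ae hK] with q a1 a2 a3
    rw [a2, map_mul, conj_weylPhase_latPt, ← a1]
    have : (latPt k l 0).1.2 = intVec l := rfl
    rw [this, ← a3]
    ring
  have hi : Integrable (fun q => K' q * (starRingEnd ℂ) (T q)) volume :=
    integrable_mul_of_memLp_two (Lp.memLp K') (Lp.memLp T).star
  have hi2 := hi.congr hae
  refine ⟨Integrable.integral_prod_left hi2, ?_⟩
  have e : (inner ℂ T K' : ℂ) = ∫ q, K' q * (starRingEnd ℂ) (T q) := by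
    rw [L2.inner_def]
    rfl
  rw [e, integral_congr_ae hae, integral_volume_prod hi2]
  rfl

theorem crossCorr_add_intVec (k l s : Fin n → ℤ) (lam : ℝ) (r : ℤ) (K : EucSp n → EucSp n → ℂ)
    (ξ : EucSp n) :
    crossCorr k l (lam + r) K (ξ + intVec s) =
      ∫ η : EucSp n, K (ξ + intVec s) η *
        (starRingEnd ℂ) (K (ξ + intVec s + intVec l) η) *
        Complex.exp (-(2 * Real.pi * (lam + r) *
          ((inner ℝ (intVec k) (intVec l + (2 : ℝ) • ξ) : ℝ) : ℂ) * Complex.I)) *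
        Complex.exp (-(4 * Real.pi * lam *
          ((inner ℝ (intVec k) (intVec s) : ℝ) : ℂ) * Complex.I)) := by
  rw [crossCorr]
  congr 1
  funext η
  rw [mul_assoc _ (Complex.exp _) (Complex.exp _), ← Complex.exp_add]
  congr 1
  -- the phase `e^{-4πi r k·s}` is trivial
  rw [Complex.exp_eq_exp_iff_exists_int]
  refine ⟨-(2 * r * ∑ i, k i * s i), ?_⟩
  simp only [inner_add_right, inner_smul_right, inner_intVec]
  push_cast
  ring

theorem G_ae_eq_bracket (φ : L2Heis n) (k l : Fin n → ℤ) :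
    ∀ᵐ lam : ℝ, G φ k l lam = bracket φ (leftTrans (latPt k l 0) φ) lam := by
  filter_upwards [ae_forall_add_int (crossCorr_integrable_integral k l φ)] with lam h
  rw [G, bracket]
  congr 1
  funext r
  rw [tsum_mul_right, ← (h r).2]
  congr 1
  refine Eq.trans ?_ (hasSum_integral_unitCube (h r).1).tsum_eq
  congr 1
  funext s
  congr 1
  funext ξ
  exact (crossCorr_add_intVec k l s lam r _ ξ).symm

/-! ### Periodization and Fourier coefficients -/

theorem integrable_tsum_of_lintegral {X ι : Type*} [Countable ι] [MeasurableSpace X]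
    {μ : Measure X} {F : ι → X → ℂ} (hF : ∀ i, AEStronglyMeasurable (F i) μ)
    (h : ∑' i, ∫⁻ x, ‖F i x‖ₑ ∂μ ≠ ⊤) : Integrable (fun x => ∑' i, F i x) μ := by
  rw [← lintegral_tsum fun i => (hF i).enorm] at h
  have hs : ∀ᵐ x ∂μ, Summable fun i => F i x := by
    filter_upwards [ae_lt_top' (AEMeasurable.tsum fun i => (hF i).enorm) h] with x hx
    exact .of_enorm hx.ne
  refine ⟨?_, ?_⟩
  · refine aestronglyMeasurable_of_tendsto_ae (atTop : Filter (Finset ι))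
      (f := fun s x => ∑ i ∈ s, F i x)
      (fun s => Finset.aestronglyMeasurable_fun_sum s fun i _ => hF i) ?_
    filter_upwards [hs] with x hx
    exact hx.hasSum
  · exact (lintegral_mono fun x => enorm_tsum_le_tsum_enorm).trans_lt h.lt_top

/-- Folding an integral over the line onto `(0,1]`. -/
theorem integral_periodization {J : ℝ → ℂ} (hJ : Integrable J) :
    IntegrableOn (fun lam => ∑' r : ℤ, J (lam + r)) (Set.Ioc 0 1) ∧
      ∫ lam in Set.Ioc (0 : ℝ) 1, ∑' r : ℤ, J (lam + r) = ∫ lam, J lam := by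
  have hm : ∀ r : ℤ, AEStronglyMeasurable (fun lam : ℝ => J (lam + r))
      (volume.restrict (Set.Ioc 0 1)) := fun r =>
    (hJ.comp_add_right (r : ℝ)).1.restrict
  have hfin : ∑' r : ℤ, ∫⁻ lam in Set.Ioc (0 : ℝ) 1, ‖J (lam + r)‖ₑ ≠ ⊤ := by
    have e : ∀ r : ℤ, ∫⁻ lam in Set.Ioc (0 : ℝ) 1, ‖J (lam + r)‖ₑ =
        ∫⁻ lam in Set.Ioc (r : ℝ) (r + 1), ‖J lam‖ₑ := by
      intro r
      have hp := measurePreserving_add_right (volume : Measure ℝ) (r : ℝ)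
      have := hp.setLIntegral_comp_preimage_emb
        (Homeomorph.addRight (r : ℝ)).measurableEmbedding (fun x => ‖J x‖ₑ)
        (Set.Ioc (r : ℝ) (r + 1))
      rw [← this]
      simp
    simp_rw [e]
    rw [← lintegral_iUnion (fun _ => measurableSet_Ioc) (Set.pairwise_disjoint_Ioc_intCast ℝ),
      iUnion_Ioc_intCast, setLIntegral_univ]
    exact hJ.2.ne
  refine ⟨integrable_tsum_of_lintegral hm hfin, ?_⟩
  rw [integral_tsum hm hfin, ← hJ.hasSum_intervalIntegral_comp_add_int.tsum_eq]
  simp_rw [intervalIntegral.integral_of_le zero_le_one]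

/-- An integrable function on `(0,1]` all of whose Fourier coefficients vanish is zero. -/
theorem ae_eq_zero_of_fourier_coeff_eq_zero {g : ℝ → ℂ} (hg : IntegrableOn g (Set.Ioc 0 1))
    (h : ∀ m : ℤ, ∫ lam in Set.Ioc (0 : ℝ) 1,
      Complex.exp (-(2 * Real.pi * lam * m * Complex.I)) * g lam = 0) :
    ∀ᵐ lam ∂(volume.restrict (Set.Ioc (0 : ℝ) 1)), g lam = 0 := by
  have hint : ∀ p : C(AddCircle (1 : ℝ), ℂ),
      IntegrableOn (fun lam : ℝ => p lam * g lam) (Set.Ioc 0 1) := fun p =>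
    hg.bdd_mul (c := ‖p‖) (p.continuous.comp (AddCircle.continuous_mk' 1)).aestronglyMeasurable
      (Eventually.of_forall fun x => p.norm_coe_le_norm _)
  let Λ : C(AddCircle (1 : ℝ), ℂ) →L[ℂ] ℂ := LinearMap.mkContinuous
    { toFun := fun p => ∫ lam in Set.Ioc (0 : ℝ) 1, p lam * g lam
      map_add' := fun p q => by
        rw [← integral_add (hint p) (hint q)]
        simp only [ContinuousMap.add_apply, add_mul]
      map_smul' := fun a p => by
        rw [RingHom.id_apply, ← integral_smul]
        simp only [ContinuousMap.smul_apply, smul_eq_mul, mul_assoc] }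
    (∫ lam in Set.Ioc (0 : ℝ) 1, ‖g lam‖) fun p => by
      refine (norm_integral_le_integral_norm _).trans ?_
      rw [mul_comm, ← integral_const_mul]
      refine integral_mono (hint p).norm (hg.norm.const_mul _) fun lam => ?_
      simp only [norm_mul]
      exact mul_le_mul_of_nonneg_right (p.norm_coe_le_norm _) (norm_nonneg _)
  have hΛ : ∀ p, Λ p = 0 := by
    intro p
    have hp : p ∈ (Submodule.span ℂ (Set.range (@fourier 1))).topologicalClosure := by
      rw [span_fourier_closure_eq_top]
      trivial
    have hle : (Submodule.span ℂ (Set.range (@fourier 1))).topologicalClosure ≤ Λ.ker := by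
      refine Submodule.topologicalClosure_minimal _ (Submodule.span_le.2 ?_) Λ.isClosed_ker
      rintro _ ⟨m, rfl⟩
      change ∫ lam in Set.Ioc (0 : ℝ) 1, fourier m (lam : AddCircle (1 : ℝ)) * g lam = 0
      rw [← h (-m)]
      congr 1
      funext lam
      rw [fourier_coe_apply]
      congr 2
      push_cast
      ring
    exact hle hp
  have hU : ∀ᵐ lam : ℝ, lam ∈ Set.Ioo (0 : ℝ) 1 → g lam = 0 := by
    refine isOpen_Ioo.ae_eq_zero_of_integral_contDiff_smul_eq_zero
      (hg.mono_set Set.Ioo_subset_Ioc_self).locallyIntegrableOn fun ρ hρ _ hs => ?_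
    have h0 : ∀ x, x ∉ Set.Ioo (0 : ℝ) 1 → ρ x = 0 := fun x hx =>
      image_eq_zero_of_notMem_tsupport fun h' => hx (hs h')
    have hc : Continuous (AddCircle.liftIco (1 : ℝ) 0 fun x => (ρ x : ℂ)) := by
      refine AddCircle.liftIco_continuous ?_
        (Complex.continuous_ofReal.comp hρ.continuous).continuousOn
      simp [h0]
    have key := hΛ ⟨_, hc⟩
    change ∫ lam in Set.Ioc (0 : ℝ) 1, AddCircle.liftIco (1 : ℝ) 0 (fun x => (ρ x : ℂ))
      (lam : AddCircle (1 : ℝ)) * g lam = 0 at key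
    rw [integral_Ioc_eq_integral_Ioo] at key
    have e : ∫ x, ρ x • g x = ∫ x in Set.Ioo (0 : ℝ) 1, ρ x • g x := by
      refine (setIntegral_eq_integral_of_forall_compl_eq_zero fun x hx => ?_).symm
      rw [h0 x hx, zero_smul]
    rw [e, ← key]
    refine setIntegral_congr_fun measurableSet_Ioo fun x hx => ?_
    rw [AddCircle.liftIco_coe_apply (by simpa using Set.Ioo_subset_Ico_self hx),
      Complex.real_smul]
  rw [← restrict_Ioo_eq_restrict_Ioc, ae_restrict_iff' measurableSet_Ioo]
  exact hU

theorem integral_cexp_int (m : ℤ) : ∫ lam in Set.Ioc (0 : ℝ) 1,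
    Complex.exp (-(2 * Real.pi * lam * m * Complex.I)) = if m = 0 then 1 else 0 := by
  split_ifs with hm
  · simp [hm]
  · rw [← intervalIntegral.integral_of_le zero_le_one]
    have hc : -(2 * Real.pi * m * Complex.I) ≠ 0 := by
      simp [hm, Real.pi_ne_zero]
    have := integral_exp_mul_complex (a := 0) (b := 1) hc
    have e : ∀ lam : ℝ, -(2 * Real.pi * lam * m * Complex.I) =
        -(2 * Real.pi * m * Complex.I) * lam := fun lam => by ring
    simp_rw [e]
    rw [this]
    have e2 : Complex.exp (-(2 * Real.pi * m * Complex.I) * ((1 : ℝ) : ℂ)) = 1 :=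
      Complex.exp_eq_one_iff.2 ⟨-m, by push_cast; ring⟩
    rw [e2]
    simp

/-! ### Orthonormality of the lattice translates -/

theorem integral_inner_slice (φ ψ : L2Heis n) :
    ∫ lam : ℝ, (inner ℂ (slice (centralFourier n ψ) lam) (slice (centralFourier n φ) lam) : ℂ) =
      inner ℂ ψ φ := by
  rw [← inner_centralFourier, integral_congr_ae (inner_slice _ _), L2.inner_def]
  exact (integral_prod_symm _ (integrable_mul_conj _ _)).symm

theorem slice_leftTrans_latPt (k l : Fin n → ℤ) (m : ℤ) (φ : L2Heis n) : ∀ᵐ lam : ℝ,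
    slice (centralFourier n (leftTrans (latPt k l m) φ)) lam =
      Complex.exp (2 * Real.pi * lam * m * Complex.I) •
        slice (centralFourier n (leftTrans (latPt k l 0) φ)) lam := by
  filter_upwards [slice_leftTrans (latPt k l m) φ, slice_leftTrans (latPt k l 0) φ]
    with lam h1 h2
  rw [h1, h2]
  refine Lp.ext ((coeFn_twist _ _ _ _).trans ?_)
  refine EventuallyEq.trans ?_ (Lp.coeFn_smul _ _).symm
  filter_upwards [coeFn_twist (continuous_centralPhase_left (latPt k l 0) lam).aestronglyMeasurable
    (fun z => norm_centralPhase (latPt k l 0) (z, lam))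
    (measurePreserving_add_left_prod (-(latPt k l 0).1)) (slice (centralFourier n φ) lam)] with z hz
  rw [Pi.smul_apply, hz, smul_eq_mul, ← mul_assoc]
  congr 1
  rw [centralPhase, centralPhase, ← Complex.exp_add]
  congr 1
  simp only [latPt, Int.cast_zero]
  push_cast
  ring

/-- The Fourier coefficients of the bracket `[φ, L_{(2k,l,0)} φ]` are the inner products of `φ`
with its translates by `(2k, l, m)`. -/
theorem integral_bracket (k l : Fin n → ℤ) (φ : L2Heis n) :
    IntegrableOn (bracket φ (leftTrans (latPt k l 0) φ)) (Set.Ioc 0 1) ∧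
    ∀ m : ℤ, ∫ lam in Set.Ioc (0 : ℝ) 1, Complex.exp (-(2 * Real.pi * lam * m * Complex.I)) *
      bracket φ (leftTrans (latPt k l 0) φ) lam = inner ℂ (leftTrans (latPt k l m) φ) φ := by
  set ψ := leftTrans (latPt k l 0) φ
  let J : ℝ → ℂ := fun lam =>
    inner ℂ (slice (centralFourier n ψ) lam) (slice (centralFourier n φ) lam)
  have hJ : Integrable J := integrable_inner_slice _ _
  have hb : ∀ᵐ lam ∂(volume.restrict (Set.Ioc (0 : ℝ) 1)),
      bracket φ ψ lam = ∑' r : ℤ, J (lam + r) := by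
    refine ae_restrict_of_ae ?_
    filter_upwards [ae_forall_add_int (hsInner_groupFourier_mul φ ψ)] with lam h
    exact tsum_congr h
  refine ⟨(integral_periodization hJ).1.congr (EventuallyEq.symm hb), fun m => ?_⟩
  have hJm : Integrable fun lam : ℝ => J lam *
      Complex.exp (-(2 * Real.pi * lam * m * Complex.I)) :=
    integrable_mul_cexp hJ (Continuous.aestronglyMeasurable (by fun_prop)) (by simp)
  calc _ = ∫ lam in Set.Ioc (0 : ℝ) 1, ∑' r : ℤ, J (lam + r) *
        Complex.exp (-(2 * Real.pi * (lam + r : ℝ) * m * Complex.I)) := by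
        refine integral_congr_ae ?_
        filter_upwards [hb] with lam h
        rw [h, ← tsum_mul_left]
        refine tsum_congr fun r => ?_
        rw [mul_comm]
        congr 1
        rw [Complex.exp_eq_exp_iff_exists_int]
        refine ⟨r * m, ?_⟩
        push_cast
        ring
    _ = ∫ lam : ℝ, J lam * Complex.exp (-(2 * Real.pi * lam * m * Complex.I)) :=
        (integral_periodization hJm).2
    _ = inner ℂ (leftTrans (latPt k l m) φ) φ := by
        rw [← integral_inner_slice]
        refine integral_congr_ae ?_
        filter_upwards [slice_leftTrans_latPt k l m φ] with lam h
        rw [h, inner_smul_left, ← Complex.exp_conj, mul_comm]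
        congr 2
        simp only [map_mul, Complex.conj_ofReal, Complex.conj_I, map_ofNat, map_intCast]
        ring

theorem heisInv_heisMul (a b : Heis n) :
    heisInv (heisMul a b) = heisMul (heisInv b) (heisInv a) := by
  simp only [heisMul, heisInv, Prod.fst_neg, Prod.snd_neg, inner_neg_left, inner_neg_right,
    Prod.mk.injEq, neg_neg]
  refine ⟨neg_add_rev _ _, ?_⟩
  rw [real_inner_comm a.1.1 b.1.2, real_inner_comm a.1.2 b.1.1]
  ring

theorem leftTrans_heisMul (a b : Heis n) (f : L2Heis n) :
    leftTrans (heisMul a b) f = leftTrans a (leftTrans b f) := by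
  refine Lp.ext ((leftTrans_ae_eq _ f).trans (EventuallyEq.trans ?_ (leftTrans_ae_eq a _).symm))
  filter_upwards [(measurePreserving_heisMul (heisInv a)).quasiMeasurePreserving.ae
    (leftTrans_ae_eq b f)] with q hq
  rw [hq, heisInv_heisMul, heisMul_assoc]

/-- Inner products of translates depend only on `q⁻¹p`. -/
theorem inner_leftTrans_of_heisMul_eq {a p q : Heis n} (h : heisMul q a = p) (φ : L2Heis n) :
    inner ℂ (leftTrans p φ) (leftTrans q φ) = inner ℂ (leftTrans a φ) φ := by
  rw [← h, leftTrans_heisMul, inner_leftTrans]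

theorem heisMul_latPt (k l k' l' : Fin n → ℤ) (m m' : ℤ) :
    heisMul (latPt k l m) (latPt k' l' m') =
      latPt (k + k') (l + l') (m + m' + (∑ i, l i * k' i - ∑ i, k i * l' i)) := by
  have hadd : ∀ v w : Fin n → ℤ, intVec v + intVec w = intVec (v + w) := fun v w => by
    ext i
    simp [intVec]
  simp only [heisMul, latPt, inner_smul_left, inner_smul_right, inner_intVec, conj_trivial,
    Prod.mk_add_mk, Prod.mk.injEq, ← smul_add, hadd, true_and]
  push_cast
  ring

/-- Since the lattice points form a subgroup, orthonormality only concerns the inner products of the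
translates with `φ` itself. -/
theorem translatesOrthonormal_iff_inner (φ : L2Heis n) :
    TranslatesOrthonormal φ ↔ ∀ (k l : Fin n → ℤ) (m : ℤ),
      inner ℂ (leftTrans (latPt k l m) φ) φ =
        if (k, l) = (0, 0) then (if m = 0 then (1 : ℂ) else 0) else 0 := by
  rw [TranslatesOrthonormal, orthonormal_iff_ite]
  constructor
  · intro h k l m
    have h1 := h ((k, l), m) ((0, 0), 0)
    rw [inner_leftTrans_of_heisMul_eq (a := latPt k l m) (by rw [heisMul_latPt]; simp)] at h1
    rw [h1]
    by_cases hk : (k, l) = (0, 0)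
    · simp [hk, Prod.ext_iff]
    · rw [if_neg hk, if_neg]
      exact fun h' => hk (congrArg Prod.fst h')
  · rintro h ⟨⟨k, l⟩, m⟩ ⟨⟨k', l'⟩, m'⟩
    rw [inner_leftTrans_of_heisMul_eq (a := latPt (k - k') (l - l')
      (m - m' - (∑ i, l' i * (k - k') i - ∑ i, k' i * (l - l') i)))
      (by
        rw [heisMul_latPt]
        congr 1
        · exact add_sub_cancel k' k
        · exact add_sub_cancel l' l
        · ring), h]
    by_cases hk : (k, l) = (k', l')
    · obtain ⟨rfl, rfl⟩ := Prod.mk.inj hk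
      simp [sub_eq_zero]
    · rw [if_neg, if_neg]
      · exact fun h' => hk (congrArg Prod.fst h')
      · intro h'
        obtain ⟨h1, h2⟩ := Prod.mk.inj h'
        exact hk (Prod.ext (sub_eq_zero.1 h1) (sub_eq_zero.1 h2))

theorem translatesOrthonormal_iff_bracket (φ : L2Heis n) :
    TranslatesOrthonormal φ ↔
      ∀ k l : Fin n → ℤ, ∀ᵐ lam ∂(volume.restrict (Set.Ioc (0 : ℝ) 1)),
        bracket φ (leftTrans (latPt k l 0) φ) lam = if (k, l) = (0, 0) then 1 else 0 := by
  rw [translatesOrthonormal_iff_inner]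
  refine forall_congr' fun k => forall_congr' fun l => ?_
  obtain ⟨hi, hb⟩ := integral_bracket k l φ
  have hc : ∀ (c : ℂ) (m : ℤ), ∫ lam in Set.Ioc (0 : ℝ) 1,
      Complex.exp (-(2 * Real.pi * lam * m * Complex.I)) * c = if m = 0 then c else 0 := by
    intro c m
    rw [integral_mul_const, integral_cexp_int]
    split_ifs <;> simp
  constructor
  · intro h
    have key := ae_eq_zero_of_fourier_coeff_eq_zero (g := fun lam =>
      bracket φ (leftTrans (latPt k l 0) φ) lam - if (k, l) = (0, 0) then 1 else 0)
      (hi.sub (integrable_const _)) fun m => by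
        simp_rw [mul_sub]
        rw [integral_sub, hb, hc, h]
        · split_ifs <;> simp
        · refine hi.bdd_mul (c := 1) (Continuous.aestronglyMeasurable (by fun_prop))
            (Eventually.of_forall fun x => (norm_cexp_eq_one (by simp)).le)
        · exact Continuous.integrableOn_Ioc (by fun_prop)
    filter_upwards [key] with lam hl
    exact sub_eq_zero.1 hl
  · intro h m
    rw [← hb m]
    refine Eq.trans (integral_congr_ae (g := fun lam : ℝ =>
      Complex.exp (-(2 * Real.pi * lam * m * Complex.I)) *
        if (k, l) = (0, 0) then 1 else 0) ?_) ?_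
    · filter_upwards [h] with lam hl
      rw [hl]
    · rw [hc]
      split_ifs <;> simp

end

theorem theorem3p2 (n : ℕ) (φ : L2Heis n) :
    (TranslatesOrthonormal φ ↔
      (∀ᵐ lam ∂(volume.restrict (Set.Ioc (0 : ℝ) 1)), G φ 0 0 lam = 1) ∧ ConditionC φ) ∧
    (TranslatesOrthonormal φ ↔
      ∀ k l : Fin n → ℤ, ∀ᵐ lam ∂(volume.restrict (Set.Ioc (0 : ℝ) 1)),
        bracket φ (leftTrans (latPt k l 0) φ) lam = if (k, l) = (0, 0) then 1 else 0) := by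
  refine ⟨?_, translatesOrthonormal_iff_bracket φ⟩
  rw [translatesOrthonormal_iff_bracket]
  have hG : ∀ (k l : Fin n → ℤ) (c : ℂ),
      (∀ᵐ lam ∂(volume.restrict (Set.Ioc (0 : ℝ) 1)), G φ k l lam = c) ↔
      ∀ᵐ lam ∂(volume.restrict (Set.Ioc (0 : ℝ) 1)),
        bracket φ (leftTrans (latPt k l 0) φ) lam = c := fun k l c => by
    refine eventually_congr ?_
    filter_upwards [ae_restrict_of_ae (G_ae_eq_bracket φ k l)] with lam h
    rw [h]
  simp only [ConditionC, hG]
  constructor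
  · refine fun h => ⟨?_, fun k l hkl => ?_⟩
    · simpa using h 0 0
    · simpa [hkl] using h k l
  · rintro ⟨h1, h2⟩ k l
    by_cases hkl : (k, l) = (0, 0)
    · obtain ⟨rfl, rfl⟩ := Prod.mk.inj hkl
      simpa using h1
    · simpa [hkl] using h2 k l hkl
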